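/- Let $M$ be an integer $d\times d$ matrix with $m:=|\det M|\ge 2$, all of whose (complex) eigenvalues are bigger than $1$ in absolute value, and let $M^*$ be its transpose. A set of digits for $M$ is a set of $m$ vectors of $\mathbb Z^d$ that contains $\mathbf 0$ and whose elements are pairwise incongruent modulo $M\mathbb Z^d$. Let $D$ and $D^*$ be sets of digits for $M$ and $M^*$, respectively, and let $\mu$ denote Lebesgue measure on $\mathbb R^d$. A representation of $x\in\mathbb R^d$ is an expansion $x=\sum_{j\in\mathbb Z}M^{-j}x_j$ with $x_j\in D$, where only finitely many $x_j$ with $j<0$ are nonzero; it is finite if only finitely many $x_j$ are nonzero. Let $X^+$ (respectively $X^0$) be the set of all $x\in\mathbb R^d$ that have a representation (respectively a finite representation; it is then unique). Let $\widetilde U$ be the set of all $u\in\mathbb R^d$ that have two expansions $u=\sum_{j\ge1}M^{-j}u_j=\sum_{j\ge1}M^{-j}u_j'$ with digits in $D$ and $u_1\ne u_1'$. Put $$\widetilde X=\bigcup_{h\in X^0}\bigcup_{n\in\mathbb Z}M^n(\widetilde U+h),\qquad X=X(M,D)=(X^+\setminus\widetilde X)\cup X^0 .$$ Every $x\in X$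 has a finite representation or else exactly one representation; the digits $x_j$ of $x\in X$ are those of its finite representation if there is one, and those of its only representation otherwise. Let $U=U(M,D)$ be the set of all $x\in X$ with $x_j=\mathbf 0$ for all $j\le 0$. Let $X^*=X(M^*,D^*)$, and let $\omega_j\in D^*$ denote the digits of $\omega\in X^*$ with respect to $M^*$ and $D^*$. For $x\in X$ and $\omega\in X^*$ put $$\chi(x,\omega)=\exp\Big(2\pi i\sum_{j\in\mathbb Z}\langle M^{-1}x_j,\omega_{1-j}\rangle\Big).$$ The Fourier transform $\widehat f$ of $f\in L^2(X)$ is the limit in $L^2(X^*)$, as $l\to+\infty$, of the functions $$J_lf(\omega)=\frac1{\mu(U)}\int_{M^l(U)}f(x)\,\overline{\chi(x,\omega)}\,d\mu(x),\qquad \omega\in X^*,\ l=0,1,2,\dots$$ Theorem. The Fourier transform maps $L^2(X)$ onto $L^2(X^*)$. That is, for every $f\in L^2(X)$ the functions $J_lf$ belong to $L^2(X^*)$ and converge there, so that $\widehat f\in L^2(X^*)$ is well defined, and for every $g\in L^2(X^*)$ there exists $f\in L^2(X)$ such that $\widehat f=g$. -/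

import Mathlib

open MeasureTheory Filter
open scoped Topology Matrix ENNReal

noncomputable section

namespace MPositive

variable {d : ℕ}

/-- `l ≡ k (mod M)`: the integer vectors `l`, `k` differ by an element of `M ℤ^d`. -/
def CongrMod (M : Matrix (Fin d) (Fin d) ℤ) (l k : Fin d → ℤ) : Prop :=
  ∃ s : Fin d → ℤ, l - k = M *ᵥ s

/-- `D` is a set of digits for `M`: it consists of `|det M|` pairwise incongruent integer vectors,
one of which is the zero vector. -/
structure IsDigitSet (M : Matrix (Fin d) (Fin d) ℤ) (D : Finset (Fin d → ℤ)) : Prop where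
  zero_mem : (0 : Fin d → ℤ) ∈ D
  card_eq : D.card = M.det.natAbs
  not_congr : ∀ s ∈ D, ∀ t ∈ D, s ≠ t → ¬ CongrMod M s t

/-- `M` is a dilation matrix: all its complex eigenvalues exceed `1` in absolute value. -/
def IsDilation (M : Matrix (Fin d) (Fin d) ℤ) : Prop :=
  ∀ z ∈ spectrum ℂ (M.map (Int.cast : ℤ → ℂ)), 1 < ‖z‖

/-- The integer matrix `M` as a real matrix. -/
def realMat (M : Matrix (Fin d) (Fin d) ℤ) : Matrix (Fin d) (Fin d) ℝ :=
  M.map (Int.cast : ℤ → ℝ)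

/-- The integer vector `v` as a real vector. -/
def realVec (v : Fin d → ℤ) : Fin d → ℝ := fun i => (v i : ℝ)

/-- `a` is an `M`-adic representation of `x`: the digits `a j` lie in `D`, only finitely many `a j`
with negative `j` are nonzero, and `x = ∑ M^{-j} a_j`, the sum being over all integers `j`. -/
structure IsRepr (M : Matrix (Fin d) (Fin d) ℤ) (D : Finset (Fin d → ℤ))
    (a : ℤ → Fin d → ℤ) (x : Fin d → ℝ) : Prop where
  mem : ∀ j, a j ∈ D
  finite_neg : {j : ℤ | j < 0 ∧ a j ≠ 0}.Finite
  hasSum : HasSum (fun j : ℤ => (realMat M ^ (-j)) *ᵥ realVec (a j)) x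

/-- `a` is a finite representation of `x`. -/
def IsFiniteRepr (M : Matrix (Fin d) (Fin d) ℤ) (D : Finset (Fin d → ℤ))
    (a : ℤ → Fin d → ℤ) (x : Fin d → ℝ) : Prop :=
  IsRepr M D a x ∧ {j : ℤ | a j ≠ 0}.Finite

/-- The set `X⁺` of all vectors that have a representation. -/
def XPlus (M : Matrix (Fin d) (Fin d) ℤ) (D : Finset (Fin d → ℤ)) : Set (Fin d → ℝ) :=
  {x | ∃ a, IsRepr M D a x}

/-- The set `X⁰` of all vectors that have a finite representation. -/
def XZero (M : Matrix (Fin d) (Fin d) ℤ) (D : Finset (Fin d → ℤ)) : Set (Fin d → ℝ) :=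
  {x | ∃ a, IsFiniteRepr M D a x}

/-- The set `Ũ` of the vectors `u = ∑_{j ≥ 1} M^{-j} u_j` in `U⁺` which admit two such expansions
with different first digits. -/
def UTilde (M : Matrix (Fin d) (Fin d) ℤ) (D : Finset (Fin d → ℤ)) : Set (Fin d → ℝ) :=
  {u | ∃ a b, IsRepr M D a u ∧ IsRepr M D b u ∧
    (∀ j ≤ 0, a j = 0) ∧ (∀ j ≤ 0, b j = 0) ∧ a 1 ≠ b 1}

/-- The set `X̃ = ⋃_{h ∈ X⁰} ⋃_{n ∈ ℤ} M^n (Ũ + h)`. -/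
def XTilde (M : Matrix (Fin d) (Fin d) ℤ) (D : Finset (Fin d → ℤ)) : Set (Fin d → ℝ) :=
  ⋃ h ∈ XZero M D, ⋃ n : ℤ, (fun u : Fin d → ℝ => (realMat M ^ n) *ᵥ (u + h)) '' UTilde M D

/-- The space of `M`-positive vectors `X(M, D) = (X⁺ \ X̃) ∪ X⁰`. -/
def X (M : Matrix (Fin d) (Fin d) ℤ) (D : Finset (Fin d → ℤ)) : Set (Fin d → ℝ) :=
  (XPlus M D \ XTilde M D) ∪ XZero M D

open Classical in
/-- The digits of `x`: those of its finite representation if there is one, and those of its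
representation otherwise. Outside `X⁺`, where they are never used, they are set to `0`. -/
def digits (M : Matrix (Fin d) (Fin d) ℤ) (D : Finset (Fin d → ℤ)) (x : Fin d → ℝ) :
    ℤ → Fin d → ℤ :=
  if h : ∃ a, IsFiniteRepr M D a x then h.choose
  else if h : ∃ a, IsRepr M D a x then h.choose
  else 0

/-- The set `U(M, D)` of the vectors in `X` all of whose digits `x_j`, `j ≤ 0`, vanish. -/
def U (M : Matrix (Fin d) (Fin d) ℤ) (D : Finset (Fin d → ℤ)) : Set (Fin d → ℝ) :=
  {x | x ∈ X M D ∧ ∀ j ≤ 0, digits M D x j = 0}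

/-- `χ(x, ω) = exp (2πi ∑_j ⟨M⁻¹ x_j, ω_{1-j}⟩)`, with `x_j` the digits of `x` with respect to
`(M, D)` and `ω_j` those of `ω` with respect to `(Mᵀ, D')`. Only finitely many terms of the sum are
nonzero. -/
def chi (M : Matrix (Fin d) (Fin d) ℤ) (D D' : Finset (Fin d → ℤ)) (x ω : Fin d → ℝ) : ℂ :=
  Complex.exp (2 * (Real.pi : ℂ) * Complex.I *
    ((∑ᶠ j : ℤ, ((realMat M)⁻¹ *ᵥ realVec (digits M D x j)) ⬝ᵥ
      realVec (digits Mᵀ D' ω (1 - j)) : ℝ) : ℂ))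

/-- The measure space underlying `L^p(X)`: Lebesgue measure on `X`. -/
def muX (M : Matrix (Fin d) (Fin d) ℤ) (D : Finset (Fin d → ℤ)) : Measure (Fin d → ℝ) :=
  volume.restrict (X M D)

/-- `J_l f (ω) = μ(U)⁻¹ ∫_{M^l(U)} f(x) conj χ(x, ω) dμ(x)`. -/
def J (M : Matrix (Fin d) (Fin d) ℤ) (D D' : Finset (Fin d → ℤ)) (l : ℕ)
    (f : (Fin d → ℝ) → ℂ) (ω : Fin d → ℝ) : ℂ :=
  ((volume (U M D)).toReal : ℂ)⁻¹ *
    ∫ x in (fun u : Fin d → ℝ => (realMat M ^ l) *ᵥ u) '' U M D,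
      f x * (starRingEnd ℂ) (chi M D D' x ω)

/-- `F ∈ L²(X*)` is the Fourier transform of `f ∈ L²(X)`: the functions `J_l f` belong to `L²(X*)`
and converge to `F` in `L²(X*)` as `l → ∞`. -/
def IsFourierTransform (M : Matrix (Fin d) (Fin d) ℤ) (D D' : Finset (Fin d → ℤ))
    (f : Lp ℂ 2 (muX M D)) (F : Lp ℂ 2 (muX Mᵀ D')) : Prop :=
  (∀ l : ℕ, MemLp (J M D D' l f) 2 (muX Mᵀ D')) ∧
    Tendsto (fun l : ℕ => eLpNorm (J M D D' l f - (F : (Fin d → ℝ) → ℂ)) 2 (muX Mᵀ D'))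
      atTop (𝓝 0)

end MPositive

end

/-!
The proof treats `X(M, D)` as a measure space whose points are digit sequences.

The tile `U⁺ = {∑_{j ≥ 1} M^{-j} a_j}` is compact, and `M U⁺` is the union of its translates by the
`m` digits. Comparing measures, these translates overlap in null sets
(`volume_cylSet_single_inter`), so `X̃` is a null set (`volume_xTilde`), while outside of `X̃`
representations are unique (`eq_of_isRepr`). The integer translates of the tile cover the space
(`iUnion_tile_add`), so the tile has positive measure `c`. Hence, up to a null set, the vectors with
prescribed digits up to the index `k` form an affine image of the tile, and all these cylinders have
measure `c m^{-k}`. They are total in `L²`, since a vector is the limit of its truncated expansions.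
This is `isDigitSpace_muX`. The same holds for `X* = X(Mᵀ, D')`, with some constant `c'`.

The kernel `χ(x, ω)` is the product of the numbers `exp (2πi ⟨M⁻¹ x_j, ω_{1-j}⟩)`, the entries of
the character table of the finite group `ℤ^d / Mᵀ ℤ^d`, whose rows are orthogonal
(`sum_expPairing_mul_conj`). If `x` has only zero digits up to `-l` and `ω` only zero digits up to
`-k`, then `χ(x, ω)` depends only on the `l + k` digits of `x` in `(-l, k]` and on as many digits of
`ω`, so `J_l f` is given there by a tensor power of this finite matrix. Parseval's identity for
the matrix and the Cauchy–Schwarz inequality on cylinders give, letting `k → ∞`,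
`‖J_l f‖² ≤ (c' / c) ‖f‖²`, where the norm of `f` is taken over `M^l U` only
(`lintegral_truncTransform_le`). For `l ≤ l'` the difference of `J_l' f` and `J_l f` is `J_l'` of the
part of `f` outside of `M^l U`, so `J_l f` converges in `L²`, and the limit defines a bounded
operator `F`.

For surjectivity, let `G` be the analogous operator from `L²(X*)` to `L²(X)` with the conjugate
kernel. If `g` is the indicator function of a cylinder of level `k` of `X*`, then on `M^k U` the
function `G g` is `m^{-k} χ(·, ω₀)` for any `ω₀` in the cylinder. Its norm on this set is already
the largest one allowed by the above inequality, so `G g` vanishes elsewhere. Now `F (G g)` is `1` on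
the cylinder, and vanishes elsewhere for the same reason, that is, `F (G g) = g`
(`transform_transform_indicator`). By density `F ∘ G` is the identity.
-/

namespace MPositive

/-! ### Digit spaces and their cylinders -/

/-- The cylinder of the points whose digits of index at most `k` are those of the sequence `h`. -/
def cyl {Ω A : Type*} (δ : Ω → ℤ → A) (k : ℤ) (h : ℤ → A) : Set Ω := {x | ∀ j ≤ k, δ x j = h j}

/-- The sequence `h` vanishes far to the left. -/
def LeftFinite {A : Type*} [Zero A] (h : ℤ → A) : Prop := ∃ l : ℕ, ∀ j ≤ -(l : ℤ), h j = 0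

/-- A measure space whose points are encoded by left-finite digit sequences, in such a way that all
cylinders of level `k` have the same measure `c m^{-k}`, where `m` is the number of digits, and that
the cylinders are total in `L²`. -/
structure IsDigitSpace {Ω A : Type*} [MeasurableSpace Ω] [Fintype A] [Zero A] (ν : Measure Ω)
    (δ : Ω → ℤ → A) (c : ℝ) : Prop where
  pos : 0 < c
  leftFinite : ∀ x, LeftFinite (δ x)
  measurableSet_cyl : ∀ k h, LeftFinite h → MeasurableSet (cyl δ k h)
  measure_cyl : ∀ k h, LeftFinite h →
    ν (cyl δ k h) = ENNReal.ofReal (c * (Fintype.card A : ℝ) ^ (-k))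
  eq_zero_of_forall_cyl : ∀ f : Lp ℂ 2 ν,
    (∀ (k : ℕ) h, LeftFinite h → ∫ x in cyl δ k h, f x ∂ν = 0) → f = 0

/-- A kernel `χ` between two spaces with digits which is the product over `j` of the values
`e x_j ω_{1-j}`, where `e` is a complex Hadamard matrix. The product is taken over any finite range
of indices outside of which the digits are known to vanish. -/
structure IsDigitKernel {Ω Ω' A A' : Type*} [Fintype A] [Zero A] [Fintype A'] [Zero A']
    (δ : Ω → ℤ → A) (δ' : Ω' → ℤ → A') (e : A → A' → ℂ) (χ : Ω → Ω' → ℂ) : Prop where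
  card_eq : Fintype.card A = Fintype.card A'
  norm_eq : ∀ s t, ‖e s t‖ = 1
  orthogonal : ∀ s s', s ≠ s' → ∑ t, e s t * (starRingEnd ℂ) (e s' t) = 0
  orthogonal' : ∀ t t', t ≠ t' → ∑ s, e s t * (starRingEnd ℂ) (e s t') = 0
  eq_prod : ∀ (l k : ℕ) (x : Ω) (ω : Ω'), x ∈ cyl δ (-l) 0 → ω ∈ cyl δ' (-k) 0 →
    χ x ω = ∏ j ∈ Finset.Ioc (-(l : ℤ)) k, e (δ x j) (δ' ω (1 - j))

/-- Extension by zero of a block of digits, indexed by the integers in `(-l, k]`. -/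
noncomputable def extendZero {A : Type*} [Zero A] {l k : ℕ} (t : Finset.Ioc (-(l : ℤ)) k → A)
    (j : ℤ) : A :=
  if h : j ∈ Finset.Ioc (-(l : ℤ)) k then t ⟨j, h⟩ else 0

section Cylinders

variable {Ω A : Type*} [Zero A] {δ : Ω → ℤ → A}

lemma leftFinite_zero : LeftFinite (0 : ℤ → A) := ⟨0, fun _ _ => rfl⟩

lemma leftFinite_extendZero {l k : ℕ} (t : Finset.Ioc (-(l : ℤ)) k → A) :
    LeftFinite (extendZero t) := ⟨l, fun j hj => by simp [extendZero, hj.not_gt]⟩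

lemma leftFinite_extendZero_reflect {l k : ℕ} (t : Finset.Ioc (-(l : ℤ)) k → A) :
    LeftFinite (fun i => extendZero t (1 - i)) := ⟨k, fun j hj => by
  have : ¬ (1 - j ≤ (k : ℤ)) := by omega
  simp [extendZero, this]⟩

lemma extendZero_coe {l k : ℕ} (t : Finset.Ioc (-(l : ℤ)) k → A)
    (j : Finset.Ioc (-(l : ℤ)) (k : ℤ)) : extendZero t j = t j := by
  simp only [extendZero, dif_pos j.2]

lemma cyl_zero_mono {l l' : ℕ} (h : l ≤ l') : cyl δ (-l) 0 ⊆ cyl δ (-l') 0 :=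
  fun _ hx j hj => hx j (by omega)

lemma iUnion_cyl_zero (hδ : ∀ x, LeftFinite (δ x)) : ⋃ l : ℕ, cyl δ (-l) 0 = Set.univ :=
  Set.eq_univ_of_forall fun x => Set.mem_iUnion.2 (hδ x)

lemma cyl_extendZero_subset {l k : ℕ} (t : Finset.Ioc (-(l : ℤ)) k → A) :
    cyl δ k (extendZero t) ⊆ cyl δ (-l) 0 := fun x hx j hj => by
  rw [hx j (by omega), extendZero, dif_neg]
  · rfl
  · simp [hj.not_gt]

lemma iUnion_cyl_extendZero (l k : ℕ) :
    ⋃ t : Finset.Ioc (-(l : ℤ)) k → A, cyl δ k (extendZero t) = cyl δ (-l) 0 := by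
  refine Set.Subset.antisymm (Set.iUnion_subset fun t => cyl_extendZero_subset t) fun x hx => ?_
  refine Set.mem_iUnion.2 ⟨fun j => δ x j, fun j hj => ?_⟩
  by_cases h : -(l : ℤ) < j
  · simp [extendZero, h, hj]
  · simpa [extendZero, h] using hx j (by omega)

lemma pairwise_disjoint_cyl_extendZero (l k : ℕ) :
    Pairwise (Function.onFun Disjoint
      fun t : Finset.Ioc (-(l : ℤ)) k → A => cyl δ k (extendZero t)) := by
  intro t t' htt
  refine Set.disjoint_left.2 fun x hx hx' => htt (funext fun j => ?_)
  have hj := (Finset.mem_Ioc.1 j.2).2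
  rw [← extendZero_coe t j, ← extendZero_coe t' j, ← hx j hj, ← hx' j hj]

/-- The blocks of digits with indices in `(-k, l]`, which the kernel pairs with those in `(-l, k]`,
are parametrized by functions on the latter interval through the reflection `j ↦ 1 - j`. -/
lemma iUnion_cyl_reflect (l k : ℕ) :
    ⋃ t : Finset.Ioc (-(l : ℤ)) k → A, cyl δ l (fun i => extendZero t (1 - i))
      = cyl δ (-k) 0 := by
  refine Set.Subset.antisymm (Set.iUnion_subset fun t x hx j hj => ?_) fun x hx => ?_
  · have : 1 - j ∉ Finset.Ioc (-(l : ℤ)) k := by rw [Finset.mem_Ioc]; omega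
    rw [hx j (by omega)]
    simp only [extendZero, dif_neg this, Pi.zero_apply]
  · refine Set.mem_iUnion.2 ⟨fun j => δ x (1 - j), fun i hi => ?_⟩
    by_cases h : -(k : ℤ) < i
    · have : 1 - i ∈ Finset.Ioc (-(l : ℤ)) k := by rw [Finset.mem_Ioc]; omega
      simp only [extendZero, dif_pos this, sub_sub_cancel]
    · have : 1 - i ∉ Finset.Ioc (-(l : ℤ)) k := by rw [Finset.mem_Ioc]; omega
      simpa only [extendZero, dif_neg this, Pi.zero_apply] using hx i (by omega)

lemma eq_of_mem_cyl_reflect {l k : ℕ} {t : Finset.Ioc (-(l : ℤ)) k → A} {x : Ω}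
    (hx : x ∈ cyl δ l (fun i => extendZero t (1 - i))) (j : Finset.Ioc (-(l : ℤ)) (k : ℤ)) :
    δ x (1 - j) = t j := by
  have hj := (Finset.mem_Ioc.1 j.2)
  rw [hx (1 - j) (by omega)]
  simp only [sub_sub_cancel, extendZero_coe]

lemma pairwise_disjoint_cyl_reflect (l k : ℕ) :
    Pairwise (Function.onFun Disjoint
      fun t : Finset.Ioc (-(l : ℤ)) k → A => cyl δ l (fun i => extendZero t (1 - i))) := by
  intro t t' htt
  refine Set.disjoint_left.2 fun x hx hx' => htt (funext fun j => ?_)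
  rw [← eq_of_mem_cyl_reflect hx j, ← eq_of_mem_cyl_reflect hx' j]

end Cylinders

section Kernel

variable {Ω Ω' A A' : Type*} [Fintype A] [Zero A] [Fintype A'] [Zero A']
  {δ : Ω → ℤ → A} {δ' : Ω' → ℤ → A'} {e : A → A' → ℂ} {χ : Ω → Ω' → ℂ}

lemma IsDigitKernel.symm (hχ : IsDigitKernel δ δ' e χ) :
    IsDigitKernel δ' δ (fun t s => (starRingEnd ℂ) (e s t))
      (fun ω x => (starRingEnd ℂ) (χ x ω)) where
  card_eq := hχ.card_eq.symm
  norm_eq s t := by simp [hχ.norm_eq]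
  orthogonal t t' h := by
    rw [← map_zero (starRingEnd ℂ), ← hχ.orthogonal' t t' h, map_sum]
    simp
  orthogonal' s s' h := by
    rw [← map_zero (starRingEnd ℂ), ← hχ.orthogonal s s' h, map_sum]
    simp
  eq_prod l k ω x hω hx := by
    rw [hχ.eq_prod k l x ω hx hω, map_prod]
    refine Finset.prod_nbij' (fun j => 1 - j) (fun j => 1 - j) ?_ ?_ ?_ ?_ ?_
    all_goals simp
    all_goals omega

lemma IsDigitKernel.eq_prod_block (hχ : IsDigitKernel δ δ' e χ) {l k : ℕ} {x : Ω} {ω : Ω'}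
    (t : Finset.Ioc (-(l : ℤ)) k → A) (hx : x ∈ cyl δ k (extendZero t))
    (hω : ω ∈ cyl δ' (-k) 0) : χ x ω = ∏ j, e (t j) (δ' ω (1 - j)) := by
  rw [hχ.eq_prod l k x ω (cyl_extendZero_subset t hx) hω, ← Finset.prod_coe_sort]
  refine Finset.prod_congr rfl fun j _ => ?_
  rw [hx j (Finset.mem_Ioc.1 j.2).2, extendZero_coe]

end Kernel

/-! ### Finite Fourier matrices -/

/-- Parseval's identity for a matrix with orthogonal rows of equal length. -/
lemma sum_norm_sq_sum_conj_mul {H S : Type*} [Fintype H] [DecidableEq H] [Fintype S]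
    (E : H → S → ℂ) (N : ℝ)
    (orth : ∀ t t', ∑ s, E t s * (starRingEnd ℂ) (E t' s) = if t = t' then (N : ℂ) else 0)
    (b : H → ℂ) :
    ∑ s, ‖∑ t, (starRingEnd ℂ) (E t s) * b t‖ ^ 2 = N * ∑ t, ‖b t‖ ^ 2 := by
  have key : ((∑ s, ‖∑ t, (starRingEnd ℂ) (E t s) * b t‖ ^ 2 : ℝ) : ℂ)
      = ((N * ∑ t, ‖b t‖ ^ 2 : ℝ) : ℂ) := by
    push_cast
    simp_rw [← Complex.mul_conj', map_sum, map_mul, Complex.conj_conj, Finset.sum_mul_sum]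
    rw [Finset.sum_comm, Finset.mul_sum]
    refine Finset.sum_congr rfl fun t _ => ?_
    rw [Finset.sum_comm]
    have : ∀ t', ∑ s, (starRingEnd ℂ) (E t s) * b t * (E t' s * (starRingEnd ℂ) (b t'))
        = if t' = t then (N : ℂ) * (b t * (starRingEnd ℂ) (b t')) else 0 := by
      intro t'
      have := orth t' t
      calc _ = (∑ s, E t' s * (starRingEnd ℂ) (E t s)) * (b t * (starRingEnd ℂ) (b t')) := by
            rw [Finset.sum_mul]; exact Finset.sum_congr rfl fun s _ => by ring
        _ = _ := by rw [this]; split_ifs <;> simp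
    simp [this]
  exact_mod_cast key

/-- Orthogonality is inherited by tensor powers. -/
lemma sum_prod_mul_conj {ι A A' : Type*} [Fintype ι] [DecidableEq ι] [Fintype A] [DecidableEq A]
    [Fintype A'] {e : A → A' → ℂ} (he : ∀ s t, ‖e s t‖ = 1)
    (ho : ∀ s s', s ≠ s' → ∑ t, e s t * (starRingEnd ℂ) (e s' t) = 0) (t t' : ι → A) :
    ∑ s : ι → A', (∏ j, e (t j) (s j)) * (starRingEnd ℂ) (∏ j, e (t' j) (s j))
      = if t = t' then (((Fintype.card A' : ℝ) ^ Fintype.card ι : ℝ) : ℂ) else 0 := by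
  simp_rw [map_prod, ← Finset.prod_mul_distrib]
  rw [← Fintype.prod_sum (fun j a => e (t j) a * (starRingEnd ℂ) (e (t' j) a))]
  split_ifs with h
  · subst h
    simp [Complex.mul_conj', he]
  · obtain ⟨j, hj⟩ := Function.ne_iff.1 h
    exact Finset.prod_eq_zero (Finset.mem_univ j) (ho _ _ hj)

/-! ### The truncated transforms -/

section Transform

variable {Ω Ω' A A' : Type*} [MeasurableSpace Ω]
  [Fintype A] [Zero A] [Fintype A'] [Zero A'] {ν : Measure Ω}
  {δ : Ω → ℤ → A} {δ' : Ω' → ℤ → A'} {c c' : ℝ} {e : A → A' → ℂ} {χ : Ω → Ω' → ℂ}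

/-- The transform of `f` with kernel the conjugate of `χ`, the integral being restricted to the
points whose digits of index at most `-l` vanish. -/
noncomputable def truncTransform (ν : Measure Ω) (δ : Ω → ℤ → A) (χ : Ω → Ω' → ℂ) (c : ℝ) (l : ℕ)
    (f : Ω → ℂ) (ω : Ω') : ℂ :=
  (c : ℂ)⁻¹ * ∫ x in cyl δ (-l) 0, f x * (starRingEnd ℂ) (χ x ω) ∂ν

lemma IsDigitSpace.card_pos (_ : IsDigitSpace ν δ c) : (0 : ℝ) < Fintype.card A := by
  exact_mod_cast Fintype.card_pos_iff.2 ⟨0⟩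

lemma IsDigitSpace.measure_cyl_lt_top (hν : IsDigitSpace ν δ c) {k : ℤ} {h : ℤ → A}
    (hh : LeftFinite h) : ν (cyl δ k h) < ∞ := by
  rw [hν.measure_cyl k h hh]; exact ENNReal.ofReal_lt_top

lemma IsDigitSpace.integrableOn_cyl (hν : IsDigitSpace ν δ c) {k : ℤ} {h : ℤ → A}
    (hh : LeftFinite h) {f : Ω → ℂ} (hf : MemLp f 2 ν) : IntegrableOn f (cyl δ k h) ν := by
  have : IsFiniteMeasure (ν.restrict (cyl δ k h)) :=
    ⟨by rw [Measure.restrict_apply_univ]; exact hν.measure_cyl_lt_top hh⟩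
  exact (hf.restrict _).integrable one_le_two

/-- On each block of digits the kernel is constant, so that the truncated transform is given by a
finite Fourier matrix. -/
lemma integral_mul_kernel_cyl (hν : IsDigitSpace ν δ c) (hχ : IsDigitKernel δ δ' e χ) {l k : ℕ}
    {f : Ω → ℂ} {ω : Ω'} (hω : ω ∈ cyl δ' (-k) 0) (t : Finset.Ioc (-(l : ℤ)) k → A) :
    ∫ x in cyl δ k (extendZero t), f x * (starRingEnd ℂ) (χ x ω) ∂ν
      = (starRingEnd ℂ) (∏ j, e (t j) (δ' ω (1 - j))) * ∫ x in cyl δ k (extendZero t), f x ∂ν := by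
  rw [← integral_const_mul]
  refine setIntegral_congr_fun (hν.measurableSet_cyl _ _ (leftFinite_extendZero t)) fun x hx => ?_
  simp only [hχ.eq_prod_block t hx hω, mul_comm]

variable [MeasurableSpace Ω'] {ν' : Measure Ω'}

lemma integrableOn_mul_kernel (hν : IsDigitSpace ν δ c) (hν' : IsDigitSpace ν' δ' c')
    (hχ : IsDigitKernel δ δ' e χ) (l : ℕ) {f : Ω → ℂ} (hf : MemLp f 2 ν) (ω : Ω') :
    IntegrableOn (fun x => f x * (starRingEnd ℂ) (χ x ω)) (cyl δ (-l) 0) ν := by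
  obtain ⟨k, hk⟩ := hν'.leftFinite ω
  rw [← iUnion_cyl_extendZero l k, integrableOn_finite_iUnion]
  intro t
  have h := (hν.integrableOn_cyl (k := k) (leftFinite_extendZero t) hf).mul_const
    ((starRingEnd ℂ) (∏ j, e (t j) (δ' ω (1 - j))))
  refine IntegrableOn.congr_fun h (fun x hx => ?_)
    (hν.measurableSet_cyl _ _ (leftFinite_extendZero t))
  simp only [hχ.eq_prod_block t hx hk]

lemma truncTransform_eq_sum (hν : IsDigitSpace ν δ c) (hν' : IsDigitSpace ν' δ' c')
    (hχ : IsDigitKernel δ δ' e χ) (l k : ℕ) {f : Ω → ℂ} (hf : MemLp f 2 ν) {ω : Ω'}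
    (hω : ω ∈ cyl δ' (-k) 0) :
    truncTransform ν δ χ c l f ω = (c : ℂ)⁻¹ * ∑ t : Finset.Ioc (-(l : ℤ)) k → A,
      (starRingEnd ℂ) (∏ j, e (t j) (δ' ω (1 - j))) *
        ∫ x in cyl δ k (extendZero t), f x ∂ν := by
  rw [truncTransform, ← iUnion_cyl_extendZero l k, integral_iUnion_fintype]
  · simp_rw [integral_mul_kernel_cyl hν hχ hω]
  · exact fun t => hν.measurableSet_cyl _ _ (leftFinite_extendZero t)
  · exact pairwise_disjoint_cyl_extendZero l k
  · exact fun t => (integrableOn_mul_kernel hν hν' hχ l hf ω).mono_set (cyl_extendZero_subset t)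

lemma measurable_truncTransform (hν : IsDigitSpace ν δ c) (hν' : IsDigitSpace ν' δ' c')
    (hχ : IsDigitKernel δ δ' e χ) (l : ℕ) {f : Ω → ℂ} (hf : MemLp f 2 ν) :
    Measurable (truncTransform ν δ χ c l f) := by
  -- The transform is the eventually constant limit of its restrictions to the cylinders of `0`.
  have h1 : ∀ k : ℕ, Measurable ((cyl δ' (-k) 0).indicator (truncTransform ν δ χ c l f)) := by
    intro k
    have : (cyl δ' (-k) 0).indicator (truncTransform ν δ χ c l f)
        = fun ω => ∑ s : Finset.Ioc (-(l : ℤ)) k → A',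
          (cyl δ' l (fun i => extendZero s (1 - i))).indicator (fun _ => (c : ℂ)⁻¹ *
            ∑ t : Finset.Ioc (-(l : ℤ)) k → A, (starRingEnd ℂ) (∏ j, e (t j) (s j)) *
            ∫ x in cyl δ k (extendZero t), f x ∂ν) ω := by
      funext ω
      by_cases hω : ω ∈ cyl δ' (-k) 0
      · rw [Set.indicator_of_mem hω, truncTransform_eq_sum hν hν' hχ l k hf hω]
        obtain ⟨s, hs⟩ := Set.mem_iUnion.1 ((iUnion_cyl_reflect (δ := δ') l k).symm ▸ hω)
        rw [Finset.sum_eq_single s, Set.indicator_of_mem hs]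
        · simp_rw [eq_of_mem_cyl_reflect hs]
        · intro s' _ hne
          refine Set.indicator_of_notMem (fun hs' => ?_) _
          exact Set.disjoint_left.1 (pairwise_disjoint_cyl_reflect l k hne) hs' hs
        · simp
      · rw [Set.indicator_of_notMem hω, Finset.sum_eq_zero]
        intro s _
        refine Set.indicator_of_notMem (fun hs => hω ?_) _
        rw [← iUnion_cyl_reflect l k]
        exact Set.mem_iUnion.2 ⟨s, hs⟩
    rw [this]
    exact Finset.measurable_fun_sum _ fun s _ => measurable_const.indicator
      (hν'.measurableSet_cyl _ _ (leftFinite_extendZero_reflect s))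
  refine measurable_of_tendsto_metrizable h1 (tendsto_pi_nhds.2 fun ω => ?_)
  obtain ⟨k, hk⟩ := hν'.leftFinite ω
  refine tendsto_const_nhds.congr' ?_
  filter_upwards [eventually_ge_atTop k] with n hn
  exact (Set.indicator_of_mem (cyl_zero_mono hn hk) _).symm

lemma enorm_sq_eq_ofReal (z : ℂ) : ‖z‖ₑ ^ 2 = ENNReal.ofReal (‖z‖ ^ 2) := by
  rw [ENNReal.ofReal_pow (norm_nonneg _), ofReal_norm]

lemma enorm_integral_sq_le {s : Set Ω} (f : Ω → ℂ) (hf : AEStronglyMeasurable f (ν.restrict s)) :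
    ‖∫ x in s, f x ∂ν‖ₑ ^ 2 ≤ ν s * ∫⁻ x in s, ‖f x‖ₑ ^ 2 ∂ν := by
  have h1 : ‖∫ x in s, f x ∂ν‖ₑ ≤ ∫⁻ x in s, ‖f x‖ₑ ∂ν := enorm_integral_le_lintegral_enorm _
  have h2 := eLpNorm_le_eLpNorm_mul_rpow_measure_univ (p := 1) (q := 2) one_le_two hf
  rw [eLpNorm_one_eq_lintegral_enorm, Measure.restrict_apply_univ,
    eLpNorm_eq_lintegral_rpow_enorm_toReal two_ne_zero ENNReal.ofNat_ne_top] at h2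
  refine (pow_le_pow_left' (h1.trans h2) 2).trans (le_of_eq ?_)
  rw [mul_pow, mul_comm, ← ENNReal.rpow_natCast, ← ENNReal.rpow_natCast, ← ENNReal.rpow_mul,
    ← ENNReal.rpow_mul]
  norm_num

/-- Bessel's inequality on a cylinder of the dual space. -/
lemma setLIntegral_truncTransform_le (hν : IsDigitSpace ν δ c) (hν' : IsDigitSpace ν' δ' c')
    (hχ : IsDigitKernel δ δ' e χ) (l k : ℕ) {f : Ω → ℂ} (hf : MemLp f 2 ν) :
    ∫⁻ ω in cyl δ' (-k) 0, ‖truncTransform ν δ χ c l f ω‖ₑ ^ 2 ∂ν'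
      ≤ ENNReal.ofReal (c' / c) * ∫⁻ x in cyl δ (-l) 0, ‖f x‖ₑ ^ 2 ∂ν := by
  classical
  set m : ℝ := (Fintype.card A' : ℝ) with hm
  have hm0 : 0 < m := hν'.card_pos
  set b : (Finset.Ioc (-(l : ℤ)) k → A) → ℂ := fun t => ∫ x in cyl δ k (extendZero t), f x ∂ν
    with hb
  set E : (Finset.Ioc (-(l : ℤ)) k → A) → (Finset.Ioc (-(l : ℤ)) k → A') → ℂ :=
    fun t s => ∏ j, e (t j) (s j) with hE
  have hcard : Fintype.card (Finset.Ioc (-(l : ℤ)) k) = l + k := by simp; omega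
  have horth := sum_prod_mul_conj (ι := Finset.Ioc (-(l : ℤ)) k) hχ.norm_eq hχ.orthogonal
  rw [hcard] at horth
  have hpars := sum_norm_sq_sum_conj_mul E (m ^ (l + k)) horth b
  have hL : ∫⁻ ω in cyl δ' (-k) 0, ‖truncTransform ν δ χ c l f ω‖ₑ ^ 2 ∂ν'
      = ENNReal.ofReal (c' * m ^ (-(l : ℤ)) * (c⁻¹ ^ 2 * (m ^ (l + k) * ∑ t, ‖b t‖ ^ 2))) := by
    rw [← iUnion_cyl_reflect l k, lintegral_iUnion
      (fun s => hν'.measurableSet_cyl _ _ (leftFinite_extendZero_reflect s))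
      (pairwise_disjoint_cyl_reflect l k), tsum_fintype]
    have : ∀ s : Finset.Ioc (-(l : ℤ)) k → A',
        ∫⁻ ω in cyl δ' l (fun i => extendZero s (1 - i)), ‖truncTransform ν δ χ c l f ω‖ₑ ^ 2 ∂ν'
        = ENNReal.ofReal (c' * m ^ (-(l : ℤ)) *
          (c⁻¹ ^ 2 * ‖∑ t, (starRingEnd ℂ) (E t s) * b t‖ ^ 2)) := by
      intro s
      have hs := leftFinite_extendZero_reflect s
      rw [setLIntegral_congr_fun (g := fun _ => ENNReal.ofReal
        (c⁻¹ ^ 2 * ‖∑ t, (starRingEnd ℂ) (E t s) * b t‖ ^ 2)) (hν'.measurableSet_cyl _ _ hs),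
        setLIntegral_const, hν'.measure_cyl _ _ hs, ← ENNReal.ofReal_mul (by positivity), mul_comm]
      intro ω hω
      have hω' : ω ∈ cyl δ' (-k) 0 := by
        rw [← iUnion_cyl_reflect l k]; exact Set.mem_iUnion.2 ⟨s, hω⟩
      simp only [truncTransform_eq_sum hν hν' hχ l k hf hω', enorm_sq_eq_ofReal,
        eq_of_mem_cyl_reflect hω, hE, hb, norm_mul, mul_pow, norm_inv, Complex.norm_real,
        Real.norm_of_nonneg hν.pos.le]
    simp_rw [this]
    have hc' := hν'.pos
    rw [← ENNReal.ofReal_sum_of_nonneg (fun _ _ => by positivity), ← Finset.mul_sum,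
      ← Finset.mul_sum, hpars]
  have hR : ∫⁻ x in cyl δ (-l) 0, ‖f x‖ₑ ^ 2 ∂ν
      = ∑ t : Finset.Ioc (-(l : ℤ)) k → A,
        ∫⁻ x in cyl δ k (extendZero t), ‖f x‖ₑ ^ 2 ∂ν := by
    rw [← iUnion_cyl_extendZero l k, lintegral_iUnion
      (fun s => hν.measurableSet_cyl _ _ (leftFinite_extendZero s))
      (pairwise_disjoint_cyl_extendZero l k), tsum_fintype]
  have hCS : ∀ t, ENNReal.ofReal (‖b t‖ ^ 2) ≤ ENNReal.ofReal (c * m ^ (-(k : ℤ))) *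
      ∫⁻ x in cyl δ k (extendZero t), ‖f x‖ₑ ^ 2 ∂ν := by
    intro t
    have := enorm_integral_sq_le (ν := ν) (s := cyl δ k (extendZero t)) f hf.1.restrict
    rwa [hν.measure_cyl _ _ (leftFinite_extendZero t), hχ.card_eq, enorm_sq_eq_ofReal] at this
  have hc := hν.pos
  have hc' := hν'.pos
  rw [hL, hR]
  have e1 : c' * m ^ (-(l : ℤ)) * (c⁻¹ ^ 2 * (m ^ (l + k) * ∑ t, ‖b t‖ ^ 2))
      = (c' * c⁻¹ ^ 2 * m ^ k) * ∑ t, ‖b t‖ ^ 2 := by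
    rw [zpow_neg, zpow_natCast, pow_add]
    field_simp
  rw [e1, ENNReal.ofReal_mul (by positivity), ENNReal.ofReal_sum_of_nonneg
    (fun _ _ => by positivity)]
  have e2 : ENNReal.ofReal (c' / c)
      = ENNReal.ofReal (c' * c⁻¹ ^ 2 * m ^ k) * ENNReal.ofReal (c * m ^ (-(k : ℤ))) := by
    rw [← ENNReal.ofReal_mul (by positivity), zpow_neg, zpow_natCast]
    congr 1
    field_simp
  rw [e2, mul_assoc (ENNReal.ofReal _), Finset.mul_sum (a := ENNReal.ofReal (c * m ^ (-(k : ℤ))))]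
  gcongr with t _
  exact hCS t

/-- Bessel's inequality for the truncated transforms. -/
lemma lintegral_truncTransform_le (hν : IsDigitSpace ν δ c) (hν' : IsDigitSpace ν' δ' c')
    (hχ : IsDigitKernel δ δ' e χ) (l : ℕ) {f : Ω → ℂ} (hf : MemLp f 2 ν) :
    ∫⁻ ω, ‖truncTransform ν δ χ c l f ω‖ₑ ^ 2 ∂ν'
      ≤ ENNReal.ofReal (c' / c) * ∫⁻ x in cyl δ (-l) 0, ‖f x‖ₑ ^ 2 ∂ν := by
  rw [← setLIntegral_univ, ← iUnion_cyl_zero hν'.leftFinite, setLIntegral_iUnion_of_directed]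
  · exact iSup_le fun k => setLIntegral_truncTransform_le hν hν' hχ l k hf
  · exact (monotone_nat_of_le_succ fun k => cyl_zero_mono (Nat.le_succ k)).directed_le

end Transform

/-! ### The transform on `L²` -/

section L2

variable {Ω : Type*} [MeasurableSpace Ω] {ν : Measure Ω}

lemma eLpNorm_two_sq (f : Ω → ℂ) : eLpNorm f 2 ν ^ 2 = ∫⁻ x, ‖f x‖ₑ ^ 2 ∂ν := by
  rw [eLpNorm_eq_lintegral_rpow_enorm_toReal two_ne_zero ENNReal.ofNat_ne_top,
    ← ENNReal.rpow_natCast, ← ENNReal.rpow_mul]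
  norm_num

lemma enorm_sq_eq_lintegral (f : Lp ℂ 2 ν) : ‖f‖ₑ ^ 2 = ∫⁻ x, ‖f x‖ₑ ^ 2 ∂ν := by
  rw [Lp.enorm_def, eLpNorm_two_sq]

lemma lintegral_enorm_sq_lt_top {f : Ω → ℂ} (hf : MemLp f 2 ν) :
    ∫⁻ x, ‖f x‖ₑ ^ 2 ∂ν < ∞ := by
  rw [← eLpNorm_two_sq]
  exact ENNReal.pow_lt_top hf.2

/-- A function whose `L²` norm is exhausted by a set vanishes outside of this set. -/
lemma ae_eq_zero_of_enorm_sq_le {s : Set Ω} (hs : MeasurableSet s) (f : Lp ℂ 2 ν)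
    (h : ‖f‖ₑ ^ 2 ≤ ∫⁻ x in s, ‖f x‖ₑ ^ 2 ∂ν) : ∀ᵐ x ∂ν, x ∉ s → f x = 0 := by
  have hfin := lintegral_enorm_sq_lt_top (Lp.memLp f)
  rw [enorm_sq_eq_lintegral, ← lintegral_add_compl _ hs] at h
  have hs_fin : ∫⁻ x in s, ‖f x‖ₑ ^ 2 ∂ν ≠ ∞ := ((setLIntegral_le_lintegral _ _).trans_lt hfin).ne
  have h0 : ∫⁻ x in sᶜ, ‖f x‖ₑ ^ 2 ∂ν = 0 := by
    refine le_antisymm ((ENNReal.add_le_add_iff_left hs_fin).1 ?_) zero_le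
    rwa [add_zero]
  rw [lintegral_eq_zero_iff' ((Lp.memLp f).1.enorm.pow_const 2).restrict] at h0
  filter_upwards [(ae_restrict_iff' hs.compl).1 h0] with x hx hxs
  replace hx := hx hxs
  simpa using hx

end L2

/-- If the digits of `x` of index at most `-k` vanish, then `χ x` is constant on the cylinders of
level `k`. -/
lemma IsDigitKernel.eq_of_mem_cyl {Ω Ω' A A' : Type*} [Fintype A] [Zero A] [Fintype A'] [Zero A']
    {δ : Ω → ℤ → A} {δ' : Ω' → ℤ → A'} {e : A → A' → ℂ} {χ : Ω → Ω' → ℂ}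
    (hχ : IsDigitKernel δ δ' e χ) {k n : ℕ} {h : ℤ → A'} (hh : ∀ j ≤ -(n : ℤ), h j = 0) {x : Ω} (hx : x ∈ cyl δ (-k) 0) {ω ω₀ : Ω'}
    (hω : ω ∈ cyl δ' k h) (hω₀ : ω₀ ∈ cyl δ' k h) : χ x ω = χ x ω₀ := by
  have hsub : ∀ ω ∈ cyl δ' k h, ω ∈ cyl δ' (-n) 0 := fun ω hω j hj => by
    rw [hω j (by omega), hh j hj]; rfl
  rw [hχ.eq_prod k n x ω hx (hsub _ hω), hχ.eq_prod k n x ω₀ hx (hsub _ hω₀)]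
  refine Finset.prod_congr rfl fun j hj => ?_
  have := (Finset.mem_Ioc.1 hj).1
  rw [hω _ (by omega), hω₀ _ (by omega)]

section Transform

variable {Ω Ω' A A' : Type*} [MeasurableSpace Ω]
  [Zero A] {ν : Measure Ω} {δ : Ω → ℤ → A} {c : ℝ} {χ : Ω → Ω' → ℂ}

lemma truncTransform_congr {f g : Ω → ℂ} (h : f =ᵐ[ν] g) (l : ℕ) :
    truncTransform ν δ χ c l f = truncTransform ν δ χ c l g := by
  funext ω
  rw [truncTransform, truncTransform, integral_congr_ae]
  filter_upwards [ae_restrict_of_ae h] with x hx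
  rw [hx]

lemma truncTransform_eq_of_le {f : Ω → ℂ} {l l' : ℕ} (hl : l ≤ l')
    (hC : MeasurableSet (cyl δ (-(l' : ℤ)) 0))
    (hf : ∀ᵐ x ∂ν, x ∉ cyl δ (-l) 0 → f x = 0) :
    truncTransform ν δ χ c l' f = truncTransform ν δ χ c l f := by
  funext ω
  rw [truncTransform, truncTransform]
  congr 1
  refine (setIntegral_eq_of_subset_of_ae_sdiff_eq_zero hC.nullMeasurableSet (cyl_zero_mono hl) ?_)
  filter_upwards [hf] with x hx hx'
  rw [hx hx'.2, zero_mul]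

variable [Fintype A] [Fintype A'] [Zero A'] [MeasurableSpace Ω'] {ν' : Measure Ω'}
  {δ' : Ω' → ℤ → A'} {c' : ℝ} {e : A → A' → ℂ}

lemma memLp_truncTransform (hν : IsDigitSpace ν δ c) (hν' : IsDigitSpace ν' δ' c')
    (hχ : IsDigitKernel δ δ' e χ) (l : ℕ) {f : Ω → ℂ} (hf : MemLp f 2 ν) :
    MemLp (truncTransform ν δ χ c l f) 2 ν' := by
  refine ⟨(measurable_truncTransform hν hν' hχ l hf).aestronglyMeasurable, ?_⟩
  have h := lintegral_truncTransform_le hν hν' hχ l hf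
  rw [← eLpNorm_two_sq] at h
  refine (ENNReal.pow_lt_top_iff (n := 2)).1 (h.trans_lt ?_) |>.resolve_right two_ne_zero
  exact ENNReal.mul_lt_top ENNReal.ofReal_lt_top
    ((setLIntegral_le_lintegral _ _).trans_lt (lintegral_enorm_sq_lt_top hf))

lemma truncTransform_add (hν : IsDigitSpace ν δ c) (hν' : IsDigitSpace ν' δ' c')
    (hχ : IsDigitKernel δ δ' e χ) (l : ℕ) {f g : Ω → ℂ} (hf : MemLp f 2 ν) (hg : MemLp g 2 ν) :
    truncTransform ν δ χ c l (f + g)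
      = truncTransform ν δ χ c l f + truncTransform ν δ χ c l g := by
  funext ω
  simp only [truncTransform, Pi.add_apply, add_mul]
  rw [integral_add (integrableOn_mul_kernel hν hν' hχ l hf ω)
    (integrableOn_mul_kernel hν hν' hχ l hg ω), mul_add]

/-- The truncated transform as an operator between `L²` spaces. -/
noncomputable def truncOp (hν : IsDigitSpace ν δ c) (hν' : IsDigitSpace ν' δ' c')
    (hχ : IsDigitKernel δ δ' e χ) (l : ℕ) : Lp ℂ 2 ν →L[ℂ] Lp ℂ 2 ν' :=
  LinearMap.mkContinuous
    { toFun := fun f => (memLp_truncTransform hν hν' hχ l (Lp.memLp f)).toLp _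
      map_add' := fun f g => by
        rw [← MemLp.toLp_add]
        refine MemLp.toLp_congr _ _ (Eventually.of_forall fun ω => ?_)
        rw [truncTransform_congr (Lp.coeFn_add f g),
          truncTransform_add hν hν' hχ l (Lp.memLp f) (Lp.memLp g)]
      map_smul' := fun a f => by
        rw [RingHom.id_apply, ← MemLp.toLp_const_smul]
        refine MemLp.toLp_congr _ _ (Eventually.of_forall fun ω => ?_)
        rw [truncTransform_congr (Lp.coeFn_smul a f)]
        simp only [truncTransform, Pi.smul_apply, smul_eq_mul, mul_assoc, integral_const_mul]
        ring }
    (Real.sqrt (c' / c)) fun f => by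
      have hc := hν.pos
      have hc' := hν'.pos
      refine abs_le_of_sq_le_sq' ?_ (by positivity) |>.2
      rw [mul_pow, Real.sq_sqrt (by positivity)]
      rw [← ENNReal.ofReal_le_ofReal_iff (by positivity), ENNReal.ofReal_mul (by positivity),
        ENNReal.ofReal_pow (norm_nonneg _), ENNReal.ofReal_pow (norm_nonneg _), ofReal_norm,
        ofReal_norm, LinearMap.coe_mk, AddHom.coe_mk, Lp.enorm_toLp, eLpNorm_two_sq,
        enorm_sq_eq_lintegral]
      exact (lintegral_truncTransform_le hν hν' hχ l (Lp.memLp f)).trans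
        (by gcongr; exact Measure.restrict_le_self)

lemma coeFn_truncOp (hν : IsDigitSpace ν δ c) (hν' : IsDigitSpace ν' δ' c')
    (hχ : IsDigitKernel δ δ' e χ) (l : ℕ) (f : Lp ℂ 2 ν) :
    truncOp hν hν' hχ l f =ᵐ[ν'] truncTransform ν δ χ c l f :=
  MemLp.coeFn_toLp (memLp_truncTransform hν hν' hχ l (Lp.memLp f))

lemma enorm_truncOp_sq_le (hν : IsDigitSpace ν δ c) (hν' : IsDigitSpace ν' δ' c')
    (hχ : IsDigitKernel δ δ' e χ) (l : ℕ) (f : Lp ℂ 2 ν) :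
    ‖truncOp hν hν' hχ l f‖ₑ ^ 2
      ≤ ENNReal.ofReal (c' / c) * ∫⁻ x in cyl δ (-l) 0, ‖f x‖ₑ ^ 2 ∂ν := by
  rw [Lp.enorm_def, eLpNorm_congr_ae (coeFn_truncOp hν hν' hχ l f), eLpNorm_two_sq]
  exact lintegral_truncTransform_le hν hν' hχ l (Lp.memLp f)

/-- The truncated transforms of `f` differ by a transform of the part of `f` off a cylinder. -/
lemma edist_truncOp_sq_le (hν : IsDigitSpace ν δ c) (hν' : IsDigitSpace ν' δ' c')
    (hχ : IsDigitKernel δ δ' e χ) {l l' : ℕ} (hl : l ≤ l') (f : Lp ℂ 2 ν) :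
    edist (truncOp hν hν' hχ l' f) (truncOp hν hν' hχ l f) ^ 2
      ≤ ENNReal.ofReal (c' / c) * ∫⁻ x in (cyl δ (-l) 0)ᶜ, ‖f x‖ₑ ^ 2 ∂ν := by
  have hC : ∀ n : ℕ, MeasurableSet (cyl δ (-(n : ℤ)) 0) :=
    fun n => hν.measurableSet_cyl _ _ leftFinite_zero
  set s := cyl δ (-(l : ℤ)) 0 with hs
  have h1 : MemLp (s.indicator f) 2 ν := (Lp.memLp f).indicator (hC l)
  have h2 : MemLp (sᶜ.indicator f) 2 ν := (Lp.memLp f).indicator (hC l).compl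
  have hsplit : truncTransform ν δ χ c l' f
      = truncTransform ν δ χ c l f + truncTransform ν δ χ c l' (sᶜ.indicator f) := by
    conv_lhs => rw [← Set.indicator_self_add_compl s (f : Ω → ℂ)]
    rw [truncTransform_add hν hν' hχ l' h1 h2]
    congr 1
    rw [truncTransform_eq_of_le hl (hC l') (Eventually.of_forall fun x hx =>
      Set.indicator_of_notMem hx _)]
    funext ω
    rw [truncTransform, truncTransform, setIntegral_congr_fun (hC l)]
    intro x hx
    simp only [Set.indicator_of_mem hx]
  have hdiff : ⇑(truncOp hν hν' hχ l' f - truncOp hν hν' hχ l f)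
      =ᵐ[ν'] truncTransform ν δ χ c l' (sᶜ.indicator f) := by
    filter_upwards [Lp.coeFn_sub (truncOp hν hν' hχ l' f) (truncOp hν hν' hχ l f),
      coeFn_truncOp hν hν' hχ l' f, coeFn_truncOp hν hν' hχ l f] with ω h1 h2 h3
    rw [h1, Pi.sub_apply, h2, h3, hsplit, Pi.add_apply, add_sub_cancel_left]
  rw [edist_eq_enorm_sub, Lp.enorm_def, eLpNorm_congr_ae hdiff, eLpNorm_two_sq]
  refine (lintegral_truncTransform_le hν hν' hχ l' h2).trans (mul_le_mul_right ?_ _)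
  calc _ ≤ ∫⁻ x, ‖sᶜ.indicator f x‖ₑ ^ 2 ∂ν := setLIntegral_le_lintegral _ _
    _ = ∫⁻ x, sᶜ.indicator (fun x => ‖f x‖ₑ ^ 2) x ∂ν := by
      refine lintegral_congr fun x => ?_
      by_cases hx : x ∈ sᶜ
      · simp only [Set.indicator_of_mem hx]
      · simp only [Set.indicator_of_notMem hx, enorm_zero]; simp
    _ = _ := lintegral_indicator (hC l).compl _

lemma tendsto_setLIntegral_compl_cyl (hν : IsDigitSpace ν δ c) (f : Lp ℂ 2 ν) :
    Tendsto (fun l : ℕ => ∫⁻ x in (cyl δ (-(l : ℤ)) 0)ᶜ, ‖f x‖ₑ ^ 2 ∂ν) atTop (𝓝 0) := by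
  have hC : ∀ n : ℕ, MeasurableSet (cyl δ (-(n : ℤ)) 0)ᶜ :=
    fun n => (hν.measurableSet_cyl _ _ leftFinite_zero).compl
  have h := tendsto_measure_iInter_atTop (μ := ν.withDensity fun x => ‖f x‖ₑ ^ 2)
    (s := fun n : ℕ => (cyl δ (-(n : ℤ)) 0)ᶜ) (fun n => (hC n).nullMeasurableSet)
    (fun m n hmn => Set.compl_subset_compl.2 (cyl_zero_mono hmn)) ⟨0, by
      rw [withDensity_apply _ (hC 0)]
      exact ((setLIntegral_le_lintegral _ _).trans_lt
        (lintegral_enorm_sq_lt_top (Lp.memLp f))).ne⟩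
  rw [← Set.compl_iUnion, iUnion_cyl_zero hν.leftFinite, Set.compl_univ, measure_empty] at h
  exact h.congr fun n => withDensity_apply _ (hC n)

lemma cauchySeq_truncOp (hν : IsDigitSpace ν δ c) (hν' : IsDigitSpace ν' δ' c')
    (hχ : IsDigitKernel δ δ' e χ) (f : Lp ℂ 2 ν) :
    CauchySeq fun l => truncOp hν hν' hχ l f := by
  refine EMetric.cauchySeq_iff'.2 fun ε hε => ?_
  have h := ENNReal.Tendsto.const_mul (a := ENNReal.ofReal (c' / c))
    (tendsto_setLIntegral_compl_cyl hν f) (Or.inr ENNReal.ofReal_ne_top)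
  rw [mul_zero] at h
  obtain ⟨N, hN⟩ := (h.eventually (gt_mem_nhds (ENNReal.pow_pos hε 2))).exists
  refine ⟨N, fun n hn => ?_⟩
  exact lt_of_pow_lt_pow_left' 2
    ((edist_truncOp_sq_le hν hν' hχ hn f).trans_lt hN)

/-- The truncated transforms converge strongly to a bounded operator. -/
lemma exists_transform (hν : IsDigitSpace ν δ c) (hν' : IsDigitSpace ν' δ' c')
    (hχ : IsDigitKernel δ δ' e χ) :
    ∃ F : Lp ℂ 2 ν →L[ℂ] Lp ℂ 2 ν', ∀ f,
      Tendsto (fun l => truncOp hν hν' hχ l f) atTop (𝓝 (F f)) := by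
  choose F hF using fun f => cauchySeq_tendsto_of_complete (cauchySeq_truncOp hν hν' hχ f)
  exact ⟨continuousLinearMapOfTendsto (truncOp hν hν' hχ) (tendsto_pi_nhds.2 hF), hF⟩

lemma enorm_transform_sq_le (hν : IsDigitSpace ν δ c) (hν' : IsDigitSpace ν' δ' c')
    (hχ : IsDigitKernel δ δ' e χ) {f : Lp ℂ 2 ν} {g : Lp ℂ 2 ν'}
    (h : Tendsto (fun l => truncOp hν hν' hχ l f) atTop (𝓝 g)) :
    ‖g‖ₑ ^ 2 ≤ ENNReal.ofReal (c' / c) * ‖f‖ₑ ^ 2 := by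
  refine le_of_tendsto ((ENNReal.continuous_pow 2).tendsto _ |>.comp h.enorm)
    (Eventually.of_forall fun l => ?_)
  refine (enorm_truncOp_sq_le hν hν' hχ l f).trans ?_
  rw [enorm_sq_eq_lintegral]
  gcongr
  exact Measure.restrict_le_self

/-- If `f` vanishes off a cylinder of `0`, then the sequence of its truncated transforms is
eventually constant. -/
lemma transform_ae_eq (hν : IsDigitSpace ν δ c) (hν' : IsDigitSpace ν' δ' c')
    (hχ : IsDigitKernel δ δ' e χ) {f : Lp ℂ 2 ν} {g : Lp ℂ 2 ν'} {l : ℕ}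
    (h : Tendsto (fun l => truncOp hν hν' hχ l f) atTop (𝓝 g))
    (hf : ∀ᵐ x ∂ν, x ∉ cyl δ (-l) 0 → f x = 0) :
    g =ᵐ[ν'] truncTransform ν δ χ c l f := by
  have : g = truncOp hν hν' hχ l f := by
    refine tendsto_nhds_unique h (tendsto_const_nhds.congr' ?_)
    filter_upwards [eventually_ge_atTop l] with n hn
    refine MemLp.toLp_congr (memLp_truncTransform hν hν' hχ l (Lp.memLp f))
      (memLp_truncTransform hν hν' hχ n (Lp.memLp f)) (Eventually.of_forall fun ω => ?_)
    rw [truncTransform_eq_of_le hn (hν.measurableSet_cyl _ _ leftFinite_zero) hf]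
  rw [this]
  exact coeFn_truncOp hν hν' hχ l f

/-- Finite combinations of indicator functions of cylinders are dense in `L²`. -/
lemma dense_span_indicator_cyl (hν : IsDigitSpace ν δ c) :
    Dense (Submodule.span ℂ {g : Lp ℂ 2 ν | ∃ (k : ℕ) (h : ℤ → A) (hh : LeftFinite h),
      g = indicatorConstLp 2 (hν.measurableSet_cyl k h hh) (hν.measure_cyl_lt_top hh).ne 1} :
      Set (Lp ℂ 2 ν)) := by
  rw [Submodule.dense_iff_topologicalClosure_eq_top, Submodule.topologicalClosure_eq_top_iff,
    Submodule.eq_bot_iff]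
  intro f hf
  refine hν.eq_zero_of_forall_cyl f fun k h hh => ?_
  rw [← L2.inner_indicatorConstLp_one (𝕜 := ℂ) (hν.measurableSet_cyl k h hh)
    (hν.measure_cyl_lt_top hh).ne]
  exact (Submodule.mem_orthogonal _ _).1 hf _ (Submodule.subset_span ⟨k, h, hh, rfl⟩)

lemma IsDigitKernel.norm_kernel (hν : IsDigitSpace ν δ c) (hν' : IsDigitSpace ν' δ' c')
    (hχ : IsDigitKernel δ δ' e χ) (x : Ω) (ω : Ω') : ‖χ x ω‖ = 1 := by
  obtain ⟨l, hl⟩ := hν.leftFinite x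
  obtain ⟨k, hk⟩ := hν'.leftFinite ω
  rw [hχ.eq_prod l k x ω hl hk, norm_prod]
  exact Finset.prod_eq_one fun j _ => hχ.norm_eq _ _

/-- The transform of the indicator function of a cylinder of level `k` with respect to the
conjugate kernel is, up to a constant, a section of the kernel on the cylinder of `0` of level
`-k`. There is no mass left for its values outside of this cylinder, and the same argument shows
that transforming back gives the indicator function again. -/
lemma transform_transform_indicator (hν : IsDigitSpace ν δ c) (hν' : IsDigitSpace ν' δ' c')
    (hχ : IsDigitKernel δ δ' e χ) {k : ℕ} {h : ℤ → A'} (hh : LeftFinite h)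
    {f : Lp ℂ 2 ν} {g : Lp ℂ 2 ν'}
    (hf : Tendsto (fun l => truncOp hν' hν hχ.symm l
      (indicatorConstLp 2 (hν'.measurableSet_cyl k h hh) (hν'.measure_cyl_lt_top hh).ne 1))
      atTop (𝓝 f))
    (hg : Tendsto (fun l => truncOp hν hν' hχ l f) atTop (𝓝 g)) :
    g = indicatorConstLp 2 (hν'.measurableSet_cyl k h hh) (hν'.measure_cyl_lt_top hh).ne 1 := by
  have hc := hν.pos
  have hc' := hν'.pos
  set m : ℝ := (Fintype.card A : ℝ) with hm
  have hm0 : 0 < m := hν.card_pos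
  set s := cyl δ' k h with hs
  have hsm : MeasurableSet s := hν'.measurableSet_cyl k h hh
  have hsν : ν' s = ENNReal.ofReal (c' * m ^ (-(k : ℤ))) := by
    rw [hν'.measure_cyl k h hh, ← hχ.card_eq]
  have hCm : MeasurableSet (cyl δ (-(k : ℤ)) 0) := hν.measurableSet_cyl _ _ leftFinite_zero
  have hCν : ν (cyl δ (-(k : ℤ)) 0) = ENNReal.ofReal (c * m ^ k) := by
    rw [hν.measure_cyl _ _ leftFinite_zero, neg_neg, zpow_natCast]
  set u : Lp ℂ 2 ν' := indicatorConstLp 2 hsm (hν'.measure_cyl_lt_top hh).ne 1 with hu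
  have huae : u =ᵐ[ν'] s.indicator fun _ => 1 := indicatorConstLp_coeFn
  have hu_norm : ‖u‖ₑ ^ 2 = ENNReal.ofReal (c' * m ^ (-(k : ℤ))) := by
    rw [enorm_sq_eq_lintegral, ← hsν, ← lintegral_indicator_one hsm]
    refine lintegral_congr_ae ?_
    filter_upwards [huae] with ω hω
    rw [hω]
    by_cases h : ω ∈ s <;> simp [h]
  obtain ⟨n, hn⟩ := hh
  have hsub : s ⊆ cyl δ' (-n) 0 := fun ω hω j hj => by
    rw [hω j (by omega), hn j hj]; rfl
  obtain ⟨ω₀, hω₀⟩ : s.Nonempty := by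
    refine nonempty_of_measure_ne_zero (μ := ν') ?_
    rw [hsν]
    exact (ENNReal.ofReal_pos.2 (by positivity)).ne'
  have hf1 := transform_ae_eq hν' hν hχ.symm (l := n) hf (by
    filter_upwards [huae] with ω hω hω'
    rw [hω, Set.indicator_of_notMem fun h => hω' (hsub h)])
  have hf2 : ∀ x ∈ cyl δ (-(k : ℤ)) 0,
      truncTransform ν' δ' (fun ω x => (starRingEnd ℂ) (χ x ω)) c' n u x
        = ((m ^ k)⁻¹ : ℝ) * χ x ω₀ := by
    intro x hx
    rw [truncTransform_congr huae, truncTransform]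
    have : ∀ ω, s.indicator (fun _ => (1 : ℂ)) ω *
        (starRingEnd ℂ) ((starRingEnd ℂ) (χ x ω)) = s.indicator (fun _ => χ x ω₀) ω := by
      intro ω
      by_cases h : ω ∈ s
      · simp [h, hχ.eq_of_mem_cyl hn hx h hω₀]
      · simp [h]
    simp_rw [this]
    rw [setIntegral_indicator hsm, Set.inter_eq_self_of_subset_right hsub, setIntegral_const,
      Measure.real, hsν, ENNReal.toReal_ofReal (by positivity), Complex.real_smul, ← mul_assoc,
      zpow_neg, zpow_natCast, ← Complex.ofReal_inv, ← Complex.ofReal_mul]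
    congr 2
    field_simp
  have hf_eq : ∀ᵐ x ∂ν, x ∈ cyl δ (-(k : ℤ)) 0 → f x = ((m ^ k)⁻¹ : ℝ) * χ x ω₀ := by
    filter_upwards [hf1] with x hx hxC
    rw [hx, hf2 x hxC]
  have hf_norm := enorm_transform_sq_le hν' hν hχ.symm hf
  rw [hu_norm, ← ENNReal.ofReal_mul (by positivity)] at hf_norm
  have hf_C : ∫⁻ x in cyl δ (-(k : ℤ)) 0, ‖f x‖ₑ ^ 2 ∂ν
      = ENNReal.ofReal (c / c' * (c' * m ^ (-(k : ℤ)))) := by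
    rw [lintegral_congr_ae (g := fun _ => ENNReal.ofReal ((m ^ k)⁻¹ ^ 2)), setLIntegral_const,
      hCν, ← ENNReal.ofReal_mul (by positivity), zpow_neg, zpow_natCast]
    · congr 1
      field_simp
    · filter_upwards [(ae_restrict_iff' hCm).2 hf_eq] with x hx
      rw [hx, enorm_sq_eq_ofReal, norm_mul, hχ.norm_kernel hν hν', Complex.norm_real, mul_one,
        Real.norm_of_nonneg (by positivity)]
  have hf0 := ae_eq_zero_of_enorm_sq_le hCm f (hf_norm.trans hf_C.ge)
  have hg1 := transform_ae_eq hν hν' hχ (l := k) hg hf0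
  have hg2 : ∀ ω ∈ s, truncTransform ν δ χ c k f ω = 1 := by
    intro ω hω
    rw [truncTransform, setIntegral_congr_ae (g := fun _ => (((m ^ k)⁻¹ : ℝ) : ℂ)) hCm,
      setIntegral_const, Measure.real, hCν, ENNReal.toReal_ofReal (by positivity),
      Complex.real_smul, ← Complex.ofReal_inv, ← Complex.ofReal_mul, ← Complex.ofReal_mul,
      ← Complex.ofReal_one]
    · congr 1
      field_simp
    · filter_upwards [hf_eq] with x hx hxC
      rw [hx hxC, hχ.eq_of_mem_cyl hn hxC hω hω₀, mul_assoc, Complex.mul_conj',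
        hχ.norm_kernel hν hν']
      simp
  have hg_eq : ∀ᵐ ω ∂ν', ω ∈ s → g ω = 1 := by
    filter_upwards [hg1] with ω hω hωs
    rw [hω, hg2 ω hωs]
  have hg_norm : ‖g‖ₑ ^ 2 ≤ ν' s := by
    refine (enorm_transform_sq_le hν hν' hχ hg).trans ?_
    refine (mul_le_mul_right hf_norm _).trans (le_of_eq ?_)
    rw [← ENNReal.ofReal_mul (by positivity), hsν]
    congr 1
    field_simp
  have hg_s : ∫⁻ ω in s, ‖g ω‖ₑ ^ 2 ∂ν' = ν' s := by
    rw [lintegral_congr_ae (g := fun _ => 1), setLIntegral_one]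
    filter_upwards [(ae_restrict_iff' hsm).2 hg_eq] with ω hω
    simp [hω]
  have hg0 := ae_eq_zero_of_enorm_sq_le hsm g (hg_norm.trans hg_s.ge)
  refine Lp.ext ?_
  filter_upwards [huae, hg0, hg_eq] with ω h1 h2 h3
  rw [h1]
  by_cases h : ω ∈ s
  · rw [h3 h, Set.indicator_of_mem h]
  · rw [h2 h, Set.indicator_of_notMem h]

/-- The transform is onto: the transform with respect to the conjugate kernel is a right inverse,
since it is one on the indicator functions of cylinders. -/
theorem exists_surjective_transform (hν : IsDigitSpace ν δ c) (hν' : IsDigitSpace ν' δ' c')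
    (hχ : IsDigitKernel δ δ' e χ) :
    ∃ F : Lp ℂ 2 ν →L[ℂ] Lp ℂ 2 ν', Function.Surjective F ∧
      ∀ f, Tendsto (fun l => truncOp hν hν' hχ l f) atTop (𝓝 (F f)) := by
  obtain ⟨F, hF⟩ := exists_transform hν hν' hχ
  obtain ⟨G, hG⟩ := exists_transform hν' hν hχ.symm
  have hFG : F.comp G = ContinuousLinearMap.id ℂ _ := by
    refine ContinuousLinearMap.ext_on (dense_span_indicator_cyl hν') ?_
    rintro _ ⟨k, h, hh, rfl⟩
    exact transform_transform_indicator hν hν' hχ hh (hG _) (hF _)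
  exact ⟨F, fun g => ⟨G g, DFunLike.congr_fun hFG g⟩, hF⟩

end Transform

/-! ### Residues modulo `M` and the finite Fourier matrix -/

section Residues

variable {d : ℕ} {M : Matrix (Fin d) (Fin d) ℤ} {D D' : Finset (Fin d → ℤ)}

lemma realVec_add (v w : Fin d → ℤ) : realVec (v + w) = realVec v + realVec w := by
  ext i; simp [realVec]

lemma realVec_sub (v w : Fin d → ℤ) : realVec (v - w) = realVec v - realVec w := by
  ext i; simp [realVec]

@[simp]
lemma realVec_zero : realVec (0 : Fin d → ℤ) = 0 := by
  ext i; simp [realVec]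

lemma realVec_injective : Function.Injective (realVec : (Fin d → ℤ) → Fin d → ℝ) := by
  intro v w h
  ext i
  simpa [realVec] using congrFun h i

lemma realVec_mulVec (M : Matrix (Fin d) (Fin d) ℤ) (v : Fin d → ℤ) :
    realVec (M *ᵥ v) = realMat M *ᵥ realVec v := by
  ext i
  simp [realVec, realMat, Matrix.mulVec, dotProduct]

lemma realVec_dotProduct (v w : Fin d → ℤ) : realVec v ⬝ᵥ realVec w = ((v ⬝ᵥ w : ℤ) : ℝ) := by
  simp [realVec, dotProduct]

lemma realMat_transpose (M : Matrix (Fin d) (Fin d) ℤ) : realMat Mᵀ = (realMat M)ᵀ := rfl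

lemma det_realMat (M : Matrix (Fin d) (Fin d) ℤ) : (realMat M).det = (M.det : ℝ) :=
  ((Int.castRingHom ℝ).map_det M).symm

lemma isUnit_det_realMat (hM : M.det ≠ 0) : IsUnit (realMat M).det := by
  rw [det_realMat, isUnit_iff_ne_zero]
  exact_mod_cast hM

lemma card_quotient_range_mulVecLin (hM : M.det ≠ 0) :
    Nat.card ((Fin d → ℤ) ⧸ LinearMap.range M.mulVecLin) = M.det.natAbs := by
  have hinj : Function.Injective M.mulVecLin := by
    refine (injective_iff_map_eq_zero _).2 fun v hv => ?_
    exact Matrix.eq_zero_of_mulVec_eq_zero hM hv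
  rw [← Submodule.natAbs_det_equiv _ (LinearEquiv.ofInjective M.mulVecLin hinj)]
  congr 1
  rw [← LinearMap.det_toLin' M]
  congr 1

/-- A set of digits represents all residue classes modulo `M`. -/
lemma exists_eq_digit_add (hM : M.det ≠ 0) (hD : IsDigitSet M D) (v : Fin d → ℤ) :
    ∃ s ∈ D, ∃ w, v = s + M *ᵥ w := by
  have hcard := card_quotient_range_mulVecLin hM
  have : Finite ((Fin d → ℤ) ⧸ LinearMap.range M.mulVecLin) :=
    Nat.finite_of_card_ne_zero (by rw [hcard]; exact Int.natAbs_ne_zero.2 hM)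
  have hbij : Function.Bijective
      (fun s : D => Submodule.Quotient.mk (p := LinearMap.range M.mulVecLin) (s : Fin d → ℤ)) := by
    refine Function.Injective.bijective_of_nat_card_le (fun s t hst => ?_) ?_
    · by_contra hne
      refine hD.not_congr s s.2 t t.2 (fun h => hne (Subtype.ext h)) ?_
      obtain ⟨w, hw⟩ := (Submodule.Quotient.eq _).1 hst
      exact ⟨w, hw.symm⟩
    · rw [hcard, Nat.card_eq_fintype_card, Fintype.card_coe, hD.card_eq]
  obtain ⟨s, hs⟩ := hbij.2 (Submodule.Quotient.mk v)
  obtain ⟨w, hw⟩ := (Submodule.Quotient.eq _).1 hs.symm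
  exact ⟨s, s.2, w, by rw [← Matrix.mulVecLin_apply, hw]; abel⟩

/-- The pairing `⟨M⁻¹ s, t⟩`. -/
noncomputable def pairing (M : Matrix (Fin d) (Fin d) ℤ) (s t : Fin d → ℤ) : ℝ :=
  ((realMat M)⁻¹ *ᵥ realVec s) ⬝ᵥ realVec t

/-- The entries `exp (2πi ⟨M⁻¹ s, t⟩)` of the finite Fourier matrix. -/
noncomputable def expPairing (M : Matrix (Fin d) (Fin d) ℤ) (s t : Fin d → ℤ) : ℂ :=
  Complex.exp (2 * (Real.pi : ℂ) * Complex.I * (pairing M s t : ℂ))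

lemma pairing_transpose (s t : Fin d → ℤ) : pairing Mᵀ t s = pairing M s t := by
  rw [pairing, pairing, realMat_transpose, ← Matrix.transpose_nonsing_inv, Matrix.mulVec_transpose,
    ← Matrix.dotProduct_mulVec, dotProduct_comm]

lemma expPairing_transpose (s t : Fin d → ℤ) : expPairing Mᵀ t s = expPairing M s t := by
  rw [expPairing, expPairing, pairing_transpose]

lemma norm_expPairing (s t : Fin d → ℤ) : ‖expPairing M s t‖ = 1 := by
  rw [expPairing, show 2 * (Real.pi : ℂ) * Complex.I * (pairing M s t : ℂ)
    = ((2 * Real.pi * pairing M s t : ℝ) : ℂ) * Complex.I by push_cast; ring]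
  exact Complex.norm_exp_ofReal_mul_I _

lemma expPairing_add_right (s t t' : Fin d → ℤ) :
    expPairing M s (t + t') = expPairing M s t * expPairing M s t' := by
  rw [expPairing, expPairing, expPairing, ← Complex.exp_add, pairing, pairing, pairing,
    realVec_add, dotProduct_add]
  push_cast
  ring_nf

lemma expPairing_mul_conj (s s' t : Fin d → ℤ) :
    expPairing M s t * (starRingEnd ℂ) (expPairing M s' t) = expPairing M (s - s') t := by
  rw [expPairing, expPairing, expPairing, ← Complex.exp_conj, ← Complex.exp_add, pairing, pairing,
    pairing, realVec_sub, Matrix.mulVec_sub, sub_dotProduct]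
  simp only [map_mul, Complex.conj_ofReal, Complex.conj_I, map_ofNat]
  push_cast
  ring_nf

lemma expPairing_mulVec_transpose (hM : M.det ≠ 0) (s w : Fin d → ℤ) :
    expPairing M s (Mᵀ *ᵥ w) = 1 := by
  have : pairing M s (Mᵀ *ᵥ w) = ((s ⬝ᵥ w : ℤ) : ℝ) := by
    rw [pairing, realVec_mulVec, realMat_transpose, Matrix.mulVec_transpose, dotProduct_comm,
      ← Matrix.dotProduct_mulVec, Matrix.mulVec_mulVec,
      Matrix.mul_nonsing_inv _ (isUnit_det_realMat hM), Matrix.one_mulVec, realVec_dotProduct,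
      dotProduct_comm]
  rw [expPairing, this]
  refine Complex.exp_eq_one_iff.2 ⟨s ⬝ᵥ w, ?_⟩
  push_cast
  ring

lemma exists_expPairing_ne_one (hM : M.det ≠ 0) {v : Fin d → ℤ} (hv : ∀ w, v ≠ M *ᵥ w) :
    ∃ t, expPairing M v t ≠ 1 := by
  by_contra! h
  have h1 : ∀ i, ∃ n : ℤ, ((realMat M)⁻¹ *ᵥ realVec v) i = n := by
    intro i
    obtain ⟨n, hn⟩ := Complex.exp_eq_one_iff.1 (h (Pi.single i 1))
    refine ⟨n, ?_⟩
    have h2 : pairing M v (Pi.single i 1) = ((realMat M)⁻¹ *ᵥ realVec v) i := by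
      have : realVec (Pi.single i 1 : Fin d → ℤ) = Pi.single i 1 := by
        ext j
        by_cases hj : j = i
        · subst hj; simp [realVec]
        · simp [realVec, hj]
      rw [pairing, this, dotProduct_single, mul_one]
    rw [h2, mul_comm] at hn
    have := mul_right_cancel₀ Complex.two_pi_I_ne_zero hn
    exact_mod_cast this
  choose w hw using h1
  refine hv w (realVec_injective ?_)
  have hw' : (realMat M)⁻¹ *ᵥ realVec v = realVec w := funext hw
  rw [realVec_mulVec, ← hw', Matrix.mulVec_mulVec,
    Matrix.mul_nonsing_inv _ (isUnit_det_realMat hM), Matrix.one_mulVec]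

/-- The rows of the finite Fourier matrix are orthogonal: a nontrivial character of
`ℤ^d / Mᵀ ℤ^d` sums to zero over a set of representatives. -/
lemma sum_expPairing_mul_conj (hM : M.det ≠ 0) (hD : IsDigitSet M D) (hD' : IsDigitSet Mᵀ D')
    {s s' : Fin d → ℤ} (hs : s ∈ D) (hs' : s' ∈ D) (hne : s ≠ s') :
    ∑ t : D', expPairing M s t * (starRingEnd ℂ) (expPairing M s' t) = 0 := by
  simp_rw [expPairing_mul_conj]
  obtain ⟨t₀, ht₀⟩ := exists_expPairing_ne_one (v := s - s') hM
    fun w hw => hD.not_congr s hs s' hs' hne ⟨w, hw⟩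
  have hM' : Mᵀ.det ≠ 0 := by rwa [Matrix.det_transpose]
  choose τ hτ w hw using fun t : D' => exists_eq_digit_add hM' hD' (t + t₀)
  have hbij : Function.Bijective fun t : D' => (⟨τ t, hτ t⟩ : D') := by
    refine Finite.injective_iff_bijective.1 fun t t' htt => ?_
    by_contra hne
    refine hD'.not_congr t t.2 t' t'.2 (fun h => hne (Subtype.ext h)) ⟨w t - w t', ?_⟩
    have h1 : τ t = τ t' := congrArg Subtype.val htt
    rw [Matrix.mulVec_sub, eq_sub_of_add_eq' (hw t).symm, eq_sub_of_add_eq' (hw t').symm, h1]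
    abel
  have h1 := Fintype.sum_bijective _ hbij (fun t : D' => expPairing M (s - s') (t + t₀))
    (fun t : D' => expPairing M (s - s') t) fun t => by
      rw [hw t, expPairing_add_right, expPairing_mulVec_transpose hM, mul_one]
  simp_rw [expPairing_add_right, ← Finset.sum_mul] at h1
  by_contra h0
  exact ht₀ (mul_left_cancel₀ h0 (h1.trans (mul_one _).symm))

end Residues

/-! ### Powers of the inverse of a dilation matrix -/

section Dilation

variable {d : ℕ} {M : Matrix (Fin d) (Fin d) ℤ}

lemma IsDilation.transpose (hM : IsDilation M) : IsDilation Mᵀ := by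
  intro z hz
  refine hM z ?_
  rw [spectrum.mem_iff] at hz ⊢
  intro h
  apply hz
  have : algebraMap ℂ (Matrix (Fin d) (Fin d) ℂ) z - Mᵀ.map (Int.cast : ℤ → ℂ)
      = (algebraMap ℂ (Matrix (Fin d) (Fin d) ℂ) z - M.map (Int.cast : ℤ → ℂ))ᵀ := by
    rw [Matrix.transpose_sub, Matrix.algebraMap_eq_diagonal, Matrix.diagonal_transpose]
    rfl
  rw [this]
  exact (Matrix.isUnit_transpose _).2 h

open scoped Matrix.Norms.Operator in
/-- The powers of the inverse of a dilation matrix are summable in norm: its spectral radius is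
less than `1`, and Gelfand's formula applies. -/
lemma exists_summable_bound (hM : M.det ≠ 0) (hdil : IsDilation M) :
    ∃ b : ℕ → ℝ, Summable b ∧ (∀ n, 0 ≤ b n) ∧
      ∀ (n : ℕ) (v : Fin d → ℝ), ‖(realMat M ^ (-(n : ℤ))) *ᵥ v‖ ≤ b n * ‖v‖ := by
  cases isEmpty_or_nonempty (Fin d)
  · exact ⟨0, summable_zero, fun _ => le_rfl, fun n v => by
      rw [Subsingleton.elim v 0]; simp⟩
  set N : Matrix (Fin d) (Fin d) ℂ := M.map (Int.cast : ℤ → ℂ) with hN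
  have hNdet : IsUnit N.det := by
    rw [show N.det = (M.det : ℂ) from ((Int.castRingHom ℂ).map_det M).symm, isUnit_iff_ne_zero]
    exact_mod_cast hM
  have hNR : N = (realMat M).map (Complex.ofRealHom) := by
    ext i j; simp [hN, realMat]
  obtain ⟨u, hu⟩ := (Matrix.isUnit_iff_isUnit_det N).2 hNdet
  have hinv : N⁻¹ = ((u⁻¹ : (Matrix (Fin d) (Fin d) ℂ)ˣ) : Matrix (Fin d) (Fin d) ℂ) := by
    rw [← hu, Matrix.coe_units_inv]
  have hrad : spectralRadius ℂ N⁻¹ < (1 : NNReal) := by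
    refine spectrum.spectralRadius_lt_of_forall_lt _ fun z hz => ?_
    have hz0 : z ≠ 0 := by
      rintro rfl
      rw [hinv] at hz
      exact spectrum.zero_notMem ℂ (u⁻¹).isUnit hz
    rw [hinv, ← inv_inv z] at hz
    have h1 := hdil z⁻¹ (by rw [← hN, ← hu]; exact spectrum.inv₀_mem_inv_iff.1 hz)
    rw [norm_inv, one_lt_inv₀ (norm_pos_iff.2 hz0)] at h1
    exact_mod_cast h1
  obtain ⟨r, hr1, hr2⟩ := ENNReal.lt_iff_exists_nnreal_btwn.1 hrad
  have hr2' : (r : ℝ) < 1 := by exact_mod_cast hr2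
  have hsum : Summable fun n : ℕ => ‖N⁻¹ ^ n‖ := by
    refine Summable.of_norm_bounded_eventually_nat (g := fun n => (r : ℝ) ^ n)
      (summable_geometric_of_lt_one r.2 hr2') ?_
    filter_upwards [(spectrum.pow_nnnorm_pow_one_div_tendsto_nhds_spectralRadius N⁻¹).eventually
      (gt_mem_nhds hr1), eventually_gt_atTop 0] with n hn hn0
    have h2 := ENNReal.rpow_le_rpow hn.le (z := n) (by positivity)
    rw [← ENNReal.rpow_mul, one_div_mul_cancel (by positivity), ENNReal.rpow_one,
      ENNReal.rpow_natCast] at h2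
    rw [norm_norm]
    exact_mod_cast h2
  refine ⟨_, hsum, fun n => norm_nonneg _, fun n v => ?_⟩
  have hmap : N⁻¹ ^ n = (realMat M ^ (-(n : ℤ))).map Complex.ofRealHom := by
    have h1 : N ^ n * (realMat M ^ (-(n : ℤ))).map Complex.ofRealHom = 1 := by
      have h2 : N ^ n = (realMat M ^ n).map Complex.ofRealHom := by
        rw [hNR, ← RingHom.mapMatrix_apply, ← RingHom.mapMatrix_apply, map_pow]
      rw [h2, ← Matrix.map_mul, Matrix.zpow_neg_natCast, Matrix.mul_nonsing_inv]
      · exact Matrix.map_one _ (map_zero _) (map_one _)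
      · rw [Matrix.det_pow]; exact (isUnit_det_realMat hM).pow n
    rw [Matrix.inv_pow']
    exact Matrix.inv_eq_right_inv h1
  have hnorm : ‖N⁻¹ ^ n‖ = ‖realMat M ^ (-(n : ℤ))‖ := by
    rw [hmap, Matrix.linfty_opNorm_def, Matrix.linfty_opNorm_def]
    simp
  rw [hnorm]
  exact Matrix.linfty_opNorm_mulVec _ _

end Dilation

/-! ### Values of digit sequences -/

section Value

variable {d : ℕ} {M : Matrix (Fin d) (Fin d) ℤ} {D : Finset (Fin d → ℤ)}

/-- The value `∑ M^{-j} a_j` of a digit sequence. -/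
noncomputable def repVal (M : Matrix (Fin d) (Fin d) ℤ) (a : ℤ → Fin d → ℤ) : Fin d → ℝ :=
  ∑' j : ℤ, (realMat M ^ (-j)) *ᵥ realVec (a j)

/-- The left-finite sequences of digits. -/
def IsDigitSeq (D : Finset (Fin d → ℤ)) (a : ℤ → Fin d → ℤ) : Prop :=
  (∀ j, a j ∈ D) ∧ LeftFinite a

lemma finite_neg_iff_leftFinite {a : ℤ → Fin d → ℤ} :
    {j : ℤ | j < 0 ∧ a j ≠ 0}.Finite ↔ LeftFinite a := by
  constructor
  · intro h
    obtain ⟨b, hb⟩ := h.bddBelow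
    refine ⟨b.natAbs + 1, fun j hj => ?_⟩
    by_contra h0
    have := hb (show j ∈ {j : ℤ | j < 0 ∧ a j ≠ 0} from ⟨by omega, h0⟩)
    omega
  · rintro ⟨l, hl⟩
    refine (Set.finite_Ioo (-(l : ℤ)) 0).subset fun j hj => ⟨?_, hj.1⟩
    by_contra h0
    exact hj.2 (hl j (by omega))

/-- A bound on the terms of nonnegative index which is uniform in the digit sequence. -/
lemma exists_summable_bound_terms (hM : M.det ≠ 0) (hdil : IsDilation M)
    (D : Finset (Fin d → ℤ)) :
    ∃ b : ℕ → ℝ, Summable b ∧ (∀ n, 0 ≤ b n) ∧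
      ∀ (n : ℕ), ∀ s ∈ D, ‖(realMat M ^ (-(n : ℤ))) *ᵥ realVec s‖ ≤ b n := by
  obtain ⟨b, hb, hb0, hle⟩ := exists_summable_bound hM hdil
  refine ⟨fun n => b n * ∑ s ∈ D, ‖realVec s‖, hb.mul_right _,
    fun n => mul_nonneg (hb0 n) (Finset.sum_nonneg fun _ _ => norm_nonneg _), fun n s hs => ?_⟩
  refine (hle n _).trans (mul_le_mul_of_nonneg_left ?_ (hb0 n))
  exact Finset.single_le_sum (f := fun s => ‖realVec s‖) (fun _ _ => norm_nonneg _) hs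

lemma IsDigitSeq.summable (hM : M.det ≠ 0) (hdil : IsDilation M) {a : ℤ → Fin d → ℤ}
    (ha : IsDigitSeq D a) : Summable fun j : ℤ => (realMat M ^ (-j)) *ᵥ realVec (a j) := by
  obtain ⟨b, hb, -, hle⟩ := exists_summable_bound_terms hM hdil D
  refine Summable.of_nat_of_neg (Summable.of_norm_bounded hb fun n => hle n _ (ha.1 n)) ?_
  obtain ⟨l, hl⟩ := ha.2
  refine summable_of_ne_finset_zero (s := Finset.range l) fun n hn => ?_
  rw [Finset.mem_range, not_lt] at hn
  rw [hl _ (by omega), realVec_zero, Matrix.mulVec_zero]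

lemma isRepr_iff (hM : M.det ≠ 0) (hdil : IsDilation M) {a : ℤ → Fin d → ℤ} {x : Fin d → ℝ} :
    IsRepr M D a x ↔ IsDigitSeq D a ∧ repVal M a = x := by
  constructor
  · intro h
    exact ⟨⟨h.mem, finite_neg_iff_leftFinite.1 h.finite_neg⟩, h.hasSum.tsum_eq⟩
  · rintro ⟨h, rfl⟩
    exact ⟨h.1, finite_neg_iff_leftFinite.2 h.2, (h.summable hM hdil).hasSum⟩

lemma repVal_zero : repVal M 0 = 0 := by
  simp [repVal]

lemma IsDigitSeq.shift {a : ℤ → Fin d → ℤ} (ha : IsDigitSeq D a) (n : ℤ) :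
    IsDigitSeq D fun j => a (j + n) := by
  refine ⟨fun j => ha.1 _, ?_⟩
  obtain ⟨l, hl⟩ := ha.2
  exact ⟨l + n.natAbs, fun j hj => hl _ (by rw [Nat.cast_add] at hj; omega)⟩

lemma mulVec_zpow_add (hM : M.det ≠ 0) (m n : ℤ) (v : Fin d → ℝ) :
    (realMat M ^ m) *ᵥ ((realMat M ^ n) *ᵥ v) = (realMat M ^ (m + n)) *ᵥ v := by
  rw [Matrix.mulVec_mulVec, Matrix.zpow_add (isUnit_det_realMat hM)]

lemma zpow_mulVec_cancel (hM : M.det ≠ 0) (n : ℤ) (v : Fin d → ℝ) :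
    (realMat M ^ (-n)) *ᵥ ((realMat M ^ n) *ᵥ v) = v := by
  rw [mulVec_zpow_add hM, neg_add_cancel, zpow_zero, Matrix.one_mulVec]

/-- Multiplication by a matrix as a continuous linear map. -/
noncomputable def mulVecCLM (A : Matrix (Fin d) (Fin d) ℝ) : (Fin d → ℝ) →L[ℝ] (Fin d → ℝ) :=
  A.mulVecLin.toContinuousLinearMap

lemma mulVecCLM_apply (A : Matrix (Fin d) (Fin d) ℝ) (v : Fin d → ℝ) : mulVecCLM A v = A *ᵥ v :=
  rfl

lemma repVal_shift (hM : M.det ≠ 0) (hdil : IsDilation M) {a : ℤ → Fin d → ℤ}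
    (ha : IsDigitSeq D a) (n : ℤ) :
    repVal M (fun j => a (j + n)) = (realMat M ^ n) *ᵥ repVal M a := by
  rw [repVal, repVal, ← mulVecCLM_apply, (mulVecCLM _).map_tsum (ha.summable hM hdil)]
  conv_rhs => rw [← (Equiv.addRight n).tsum_eq]
  refine tsum_congr fun j => ?_
  rw [mulVecCLM_apply, mulVec_zpow_add hM, Equiv.coe_addRight]
  congr 2
  ring

/-- The part of a digit sequence of index at most `k`. -/
def headSeq (k : ℤ) (a : ℤ → Fin d → ℤ) (j : ℤ) : Fin d → ℤ := if j ≤ k then a j else 0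

/-- The part of a digit sequence of index greater than `k`. -/
def tailSeq (k : ℤ) (a : ℤ → Fin d → ℤ) (j : ℤ) : Fin d → ℤ := if j ≤ k then 0 else a j

lemma IsDigitSeq.head (h0 : 0 ∈ D) {a : ℤ → Fin d → ℤ} (ha : IsDigitSeq D a) (k : ℤ) :
    IsDigitSeq D (headSeq k a) := by
  refine ⟨fun j => ?_, ?_⟩
  · rw [headSeq]; split_ifs
    exacts [ha.1 j, h0]
  · obtain ⟨l, hl⟩ := ha.2
    exact ⟨l, fun j hj => by rw [headSeq, hl j hj, ite_self]⟩

lemma IsDigitSeq.tail (h0 : 0 ∈ D) {a : ℤ → Fin d → ℤ} (ha : IsDigitSeq D a) (k : ℤ) :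
    IsDigitSeq D (tailSeq k a) := by
  refine ⟨fun j => ?_, ?_⟩
  · rw [tailSeq]; split_ifs
    exacts [h0, ha.1 j]
  · obtain ⟨l, hl⟩ := ha.2
    exact ⟨l, fun j hj => by rw [tailSeq, hl j hj, ite_self]⟩

lemma repVal_head_add_tail (hM : M.det ≠ 0) (hdil : IsDilation M) {a b : ℤ → Fin d → ℤ}
    (h0 : 0 ∈ D) (ha : IsDigitSeq D a) (hb : IsDigitSeq D b) (k : ℤ) :
    repVal M (fun j => if j ≤ k then a j else b j)
      = repVal M (headSeq k a) + repVal M (tailSeq k b) := by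
  rw [repVal, repVal, repVal, ← ((ha.head h0 k).summable hM hdil).tsum_add
    ((hb.tail h0 k).summable hM hdil)]
  refine tsum_congr fun j => ?_
  by_cases hj : j ≤ k <;> simp [headSeq, tailSeq, hj]

lemma isDigitSeq_zero (h0 : 0 ∈ D) : IsDigitSeq D 0 := ⟨fun _ => h0, leftFinite_zero⟩

/-- The set of the values of the digit sequences that agree with `h` up to the index `k`. -/
def cylSet (M : Matrix (Fin d) (Fin d) ℤ) (D : Finset (Fin d → ℤ)) (k : ℤ)
    (h : ℤ → Fin d → ℤ) : Set (Fin d → ℝ) :=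
  {x | ∃ a, IsDigitSeq D a ∧ repVal M a = x ∧ ∀ j ≤ k, a j = h j}

/-- The self-affine tile `{∑_{j ≥ 1} M^{-j} a_j}`. -/
def tile (M : Matrix (Fin d) (Fin d) ℤ) (D : Finset (Fin d → ℤ)) : Set (Fin d → ℝ) :=
  cylSet M D 0 0

/-- All cylinders are affine images of the tile. -/
lemma cylSet_eq_image (hM : M.det ≠ 0) (hdil : IsDilation M) (h0 : 0 ∈ D) (k : ℤ)
    {h : ℤ → Fin d → ℤ} (hh : IsDigitSeq D h) :
    cylSet M D k h
      = (repVal M (headSeq k h) + ·) '' ((realMat M ^ (-k)).mulVecLin '' tile M D) := by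
  ext x
  constructor
  · rintro ⟨a, ha, rfl, hah⟩
    refine ⟨_, ⟨repVal M (fun j => tailSeq k a (j + k)),
      ⟨_, (ha.tail h0 k).shift k, rfl, fun j hj => ?_⟩, rfl⟩, ?_⟩
    · simp [tailSeq, hj]
    · simp only [Matrix.mulVecLin_apply]
      rw [repVal_shift hM hdil (ha.tail h0 k), zpow_mulVec_cancel hM,
        ← repVal_head_add_tail hM hdil h0 hh ha]
      congr 1
      funext j
      by_cases hj : j ≤ k
      · simp [hj, hah j hj]
      · simp [hj]
  · rintro ⟨_, ⟨_, ⟨a, ha, rfl, haz⟩, rfl⟩, rfl⟩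
    refine ⟨fun j => if j ≤ k then h j else a (j + -k), ⟨fun j => ?_, ?_⟩, ?_, fun j hj => by
      simp [hj]⟩
    · dsimp only
      split_ifs
      exacts [hh.1 j, ha.1 _]
    · obtain ⟨l, hl⟩ := hh.2
      refine ⟨l + k.natAbs, fun j hj => ?_⟩
      rw [Nat.cast_add] at hj
      dsimp only
      rw [if_pos (by omega), hl j (by omega)]
    · rw [repVal_head_add_tail hM hdil h0 hh (ha.shift (-k)), Matrix.mulVecLin_apply,
        ← repVal_shift hM hdil ha]
      congr 2
      funext j
      by_cases hj : j ≤ k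
      · simp only [tailSeq, hj, if_true]
        exact (haz _ (by omega)).symm
      · simp [tailSeq, hj]

lemma headSeq_zero (k : ℤ) : headSeq k (0 : ℤ → Fin d → ℤ) = 0 := by
  funext j; simp [headSeq]

lemma cylSet_zero (hM : M.det ≠ 0) (hdil : IsDilation M) (h0 : 0 ∈ D) (k : ℤ) :
    cylSet M D k 0 = (realMat M ^ (-k)).mulVecLin '' tile M D := by
  rw [cylSet_eq_image hM hdil h0 k (isDigitSeq_zero h0), headSeq_zero, repVal_zero]
  simp

lemma zero_mem_tile (h0 : 0 ∈ D) : (0 : Fin d → ℝ) ∈ tile M D :=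
  ⟨0, isDigitSeq_zero h0, repVal_zero, fun _ _ => rfl⟩

/-- The tile is a continuous image of a product of finite sets. -/
lemma isCompact_tile (hM : M.det ≠ 0) (hdil : IsDilation M) : IsCompact (tile M D) := by
  set S : Set (ℤ → Fin d → ℤ) :=
    Set.univ.pi fun j => if j ≤ 0 then {0} else (D : Set (Fin d → ℤ)) with hS
  have hmem : ∀ a ∈ S, (∀ j ≤ 0, a j = 0) ∧ ∀ j, 0 < j → a j ∈ D := by
    intro a ha
    refine ⟨fun j hj => ?_, fun j hj => ?_⟩
    · have := ha j trivial
      dsimp only at this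
      rwa [if_pos hj] at this
    · have := ha j trivial
      dsimp only at this
      rwa [if_neg hj.not_ge] at this
  have hcomp : IsCompact S := by
    refine isCompact_univ_pi fun j => ?_
    split_ifs
    exacts [isCompact_singleton, D.finite_toSet.isCompact]
  obtain ⟨b, hb, hb0, hle⟩ := exists_summable_bound_terms hM hdil D
  have hcont : ContinuousOn (repVal M) S := by
    refine continuousOn_tsum (u := fun j : ℤ => if 0 < j then b j.natAbs else 0) (fun j => ?_) ?_ ?_
    · have h1 : Continuous (realVec : (Fin d → ℤ) → Fin d → ℝ) := continuous_of_discreteTopology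
      have h2 : Continuous fun a : ℤ → Fin d → ℤ => mulVecCLM (realMat M ^ (-j)) (realVec (a j)) :=
        (mulVecCLM _).continuous.comp (h1.comp (continuous_apply j))
      exact h2.continuousOn
    · refine Summable.of_nat_of_neg ?_ ?_
      · refine Summable.of_nonneg_of_le (fun n => ?_) (fun n => ?_) hb
        · split_ifs
          exacts [hb0 _, le_rfl]
        · split_ifs
          exacts [le_of_eq (by simp), hb0 _]
      · refine summable_zero.congr fun n => ?_
        rw [if_neg (by omega)]
    · intro j a ha
      split_ifs with hj
      · have := hle j.natAbs _ ((hmem a ha).2 j hj)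
        rwa [show ((j.natAbs : ℕ) : ℤ) = j by omega] at this
      · rw [(hmem a ha).1 j (by omega), realVec_zero, Matrix.mulVec_zero, norm_zero]
  have himg : tile M D ⊆ repVal M '' S := by
    rintro x ⟨a, ha, rfl, haz⟩
    refine ⟨a, fun j _ => ?_, rfl⟩
    dsimp only
    split_ifs with hj
    · exact haz j hj
    · exact ha.1 j
  by_cases h0 : (0 : Fin d → ℤ) ∈ D
  · convert hcomp.image_of_continuousOn hcont using 1
    refine himg.antisymm ?_
    rintro _ ⟨a, ha, rfl⟩
    refine ⟨a, ⟨fun j => ?_, 0, fun j hj => (hmem a ha).1 j (by simpa using hj)⟩, rfl,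
      (hmem a ha).1⟩
    by_cases hj : 0 < j
    · exact (hmem a ha).2 j hj
    · rwa [(hmem a ha).1 j (by omega)]
  · -- Without the digit `0` there are no left-finite digit sequences.
    have : tile M D = ∅ := by
      refine Set.eq_empty_of_forall_notMem fun x hx => ?_
      obtain ⟨a, ha, -, haz⟩ := hx
      have := ha.1 0
      rw [haz 0 le_rfl] at this
      exact h0 this
    rw [this]
    exact isCompact_empty

lemma isCompact_cylSet (hM : M.det ≠ 0) (hdil : IsDilation M) (h0 : 0 ∈ D) (k : ℤ)
    {h : ℤ → Fin d → ℤ} (hh : IsDigitSeq D h) : IsCompact (cylSet M D k h) := by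
  rw [cylSet_eq_image hM hdil h0 k hh]
  exact ((isCompact_tile hM hdil).image (mulVecCLM _).continuous).image (by fun_prop)

/-! ### The measure of the tile -/

lemma det_zpow_realMat (M : Matrix (Fin d) (Fin d) ℤ) (k : ℤ) :
    (realMat M ^ k).det = (M.det : ℝ) ^ k := by
  rw [← det_realMat]
  obtain ⟨n, rfl | rfl⟩ := k.eq_nat_or_neg
  · rw [zpow_natCast, zpow_natCast, Matrix.det_pow]
  · rw [Matrix.zpow_neg_natCast, Matrix.det_nonsing_inv, Matrix.det_pow, Ring.inverse_eq_inv',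
      zpow_neg, zpow_natCast]

lemma volume_image_zpow (M : Matrix (Fin d) (Fin d) ℤ) (k : ℤ) (s : Set (Fin d → ℝ)) :
    volume ((realMat M ^ k).mulVecLin '' s)
      = ENNReal.ofReal ((M.det.natAbs : ℝ) ^ k) * volume s := by
  rw [Measure.addHaar_image_linearMap, ← Matrix.toLin'_apply', LinearMap.det_toLin',
    det_zpow_realMat, abs_zpow]
  norm_num

lemma volume_cylSet (hM : M.det ≠ 0) (hdil : IsDilation M) (h0 : 0 ∈ D) (k : ℤ)
    {h : ℤ → Fin d → ℤ} (hh : IsDigitSeq D h) :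
    volume (cylSet M D k h)
      = ENNReal.ofReal ((M.det.natAbs : ℝ) ^ (-k)) * volume (tile M D) := by
  rw [cylSet_eq_image hM hdil h0 k hh, Set.image_add_left, measure_preimage_add,
    volume_image_zpow]

lemma volume_tile_lt_top (hM : M.det ≠ 0) (hdil : IsDilation M) : volume (tile M D) < ∞ :=
  (isCompact_tile hM hdil).measure_lt_top

/-- If the measure of a finite union is the sum of the measures, then the sets are essentially
disjoint. -/
lemma measure_inter_eq_zero_of_sum_le {α ι : Type*} [MeasurableSpace α] {μ : Measure α}
    {I : Finset ι} {A : ι → Set α} (hA : ∀ i ∈ I, MeasurableSet (A i)) (hfin : ∀ i ∈ I, μ (A i) ≠ ∞)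
    (h : ∑ i ∈ I, μ (A i) ≤ μ (⋃ i ∈ I, A i)) {s t : ι} (hs : s ∈ I) (ht : t ∈ I) (hne : s ≠ t) :
    μ (A s ∩ A t) = 0 := by
  classical
  have hsub : ⋃ i ∈ I, A i ⊆ (⋃ i ∈ I.erase t, A i) ∪ (A t \ A s) := by
    refine Set.iUnion₂_subset fun i hi x hx => ?_
    by_cases hit : i = t
    · subst hit
      by_cases hxs : x ∈ A s
      · exact Or.inl (Set.mem_biUnion (Finset.mem_erase.2 ⟨hne, hs⟩) hxs)
      · exact Or.inr ⟨hx, hxs⟩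
    · exact Or.inl (Set.mem_biUnion (Finset.mem_erase.2 ⟨hit, hi⟩) hx)
  have h1 : μ (⋃ i ∈ I, A i) ≤ ∑ i ∈ I.erase t, μ (A i) + μ (A t \ A s) :=
    (measure_mono hsub).trans ((measure_union_le _ _).trans
      (add_le_add (measure_biUnion_finset_le _ _) le_rfl))
  have h2 := (h.trans h1)
  rw [← Finset.add_sum_erase I _ ht, ← measure_inter_add_sdiff (A t) (hA s hs),
    add_comm (∑ i ∈ I.erase t, μ (A i)), add_assoc] at h2
  have hfin' : μ (A t \ A s) + ∑ i ∈ I.erase t, μ (A i) ≠ ∞ :=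
    ENNReal.add_ne_top.2 ⟨measure_ne_top_of_subset Set.sdiff_subset (hfin t ht),
      ENNReal.sum_ne_top.2 fun i hi => hfin i (Finset.mem_of_mem_erase hi)⟩
  rw [Set.inter_comm]
  refine le_antisymm ((ENNReal.add_le_add_iff_right hfin').1 ?_) zero_le
  rwa [zero_add]

lemma isDigitSeq_single (h0 : 0 ∈ D) {s : Fin d → ℤ} (hs : s ∈ D) :
    IsDigitSeq D (Pi.single 0 s) := by
  refine ⟨fun j => ?_, 1, fun j hj => Pi.single_eq_of_ne (by push_cast at hj; omega) _⟩
  by_cases hj : j = 0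
  · subst hj; simpa using hs
  · simpa [hj] using h0

lemma cylSet_neg_one (M : Matrix (Fin d) (Fin d) ℤ) (D : Finset (Fin d → ℤ)) :
    cylSet M D (-1) 0 = ⋃ s ∈ D, cylSet M D 0 (Pi.single 0 s) := by
  ext x
  simp only [Set.mem_iUnion]
  constructor
  · rintro ⟨a, ha, rfl, haz⟩
    refine ⟨a 0, ha.1 0, a, ha, rfl, fun j hj => ?_⟩
    by_cases hj0 : j = 0
    · subst hj0; simp
    · rw [haz j (by omega), Pi.single_eq_of_ne hj0, Pi.zero_apply]
  · rintro ⟨s, -, a, ha, rfl, has⟩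
    refine ⟨a, ha, rfl, fun j hj => ?_⟩
    rw [has j (by omega), Pi.single_eq_of_ne (by omega), Pi.zero_apply]

/-- The translates of the tile by different digits overlap in a null set, since their union is the
image of the tile under `M`. -/
lemma volume_cylSet_single_inter (hM : M.det ≠ 0) (hdil : IsDilation M) (hD : IsDigitSet M D)
    {s t : Fin d → ℤ} (hs : s ∈ D) (ht : t ∈ D) (hne : s ≠ t) :
    volume (cylSet M D 0 (Pi.single 0 s) ∩ cylSet M D 0 (Pi.single 0 t)) = 0 := by
  have h0 := hD.zero_mem
  have hvol : ∀ i ∈ D, volume (cylSet M D 0 (Pi.single 0 i)) = volume (tile M D) := fun i hi => by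
    rw [volume_cylSet hM hdil h0 0 (isDigitSeq_single h0 hi)]; simp
  refine measure_inter_eq_zero_of_sum_le (I := D) (A := fun s => cylSet M D 0 (Pi.single 0 s))
    (fun i hi => (isCompact_cylSet hM hdil h0 0 (isDigitSeq_single h0 hi)).measurableSet)
    (fun i hi => ?_) ?_ hs ht hne
  · rw [hvol i hi]; exact (volume_tile_lt_top hM hdil).ne
  · rw [← cylSet_neg_one, volume_cylSet hM hdil h0 (-1) (isDigitSeq_zero h0),
      Finset.sum_congr rfl hvol, Finset.sum_const, hD.card_eq, neg_neg, zpow_one,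
      ENNReal.ofReal_natCast, nsmul_eq_mul]

lemma uTilde_subset (hM : M.det ≠ 0) (hdil : IsDilation M) :
    UTilde M D ⊆ ⋃ s ∈ D, ⋃ t ∈ D, ⋃ _ : s ≠ t, (realMat M ^ (-1 : ℤ)).mulVecLin ''
      (cylSet M D 0 (Pi.single 0 s) ∩ cylSet M D 0 (Pi.single 0 t)) := by
  rintro u ⟨a, b, ha, hb, haz, hbz, hne⟩
  rw [isRepr_iff hM hdil] at ha hb
  have key : ∀ a, IsDigitSeq D a ∧ repVal M a = u → (∀ j ≤ 0, a j = 0) →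
      (realMat M ^ (1 : ℤ)) *ᵥ u ∈ cylSet M D 0 (Pi.single 0 (a 1)) := by
    intro a ha haz
    refine ⟨_, ha.1.shift 1, by rw [repVal_shift hM hdil ha.1, ha.2], fun j hj => ?_⟩
    by_cases hj0 : j = 0
    · subst hj0; simp
    · rw [haz _ (by omega), Pi.single_eq_of_ne hj0]
  simp only [Set.mem_iUnion]
  exact ⟨a 1, ha.1.1 1, b 1, hb.1.1 1, hne, _, ⟨key a ha haz, key b hb hbz⟩,
    zpow_mulVec_cancel hM 1 u⟩

lemma volume_uTilde (hM : M.det ≠ 0) (hdil : IsDilation M) (hD : IsDigitSet M D) :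
    volume (UTilde M D) = 0 := by
  refine measure_mono_null (uTilde_subset hM hdil) ?_
  refine (measure_biUnion_null_iff D.countable_toSet).2 fun s hs =>
    (measure_biUnion_null_iff D.countable_toSet).2 fun t ht => measure_iUnion_null fun hne => ?_
  rw [volume_image_zpow, volume_cylSet_single_inter hM hdil hD hs ht hne, mul_zero]

lemma countable_xZero (M : Matrix (Fin d) (Fin d) ℤ) (D : Finset (Fin d → ℤ)) :
    (XZero M D).Countable := by
  refine (Set.countable_range
    fun a : ℤ →₀ (Fin d → ℤ) => ∑' j : ℤ, (realMat M ^ (-j)) *ᵥ realVec (a j)).mono ?_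
  rintro x ⟨a, ha, hfin⟩
  exact ⟨Finsupp.ofSupportFinite a hfin, ha.hasSum.tsum_eq⟩

lemma volume_xTilde (hM : M.det ≠ 0) (hdil : IsDilation M) (hD : IsDigitSet M D) :
    volume (XTilde M D) = 0 := by
  refine (measure_biUnion_null_iff (countable_xZero M D)).2 fun h _ =>
    measure_iUnion_null fun n => ?_
  have : (fun u : Fin d → ℝ => (realMat M ^ n) *ᵥ (u + h)) '' UTilde M D
      = (realMat M ^ n).mulVecLin '' ((· + h) '' UTilde M D) := by
    rw [Set.image_image]; rfl
  rw [this, volume_image_zpow, Set.image_add_right, measure_preimage_add_right,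
    volume_uTilde hM hdil hD, mul_zero]

open scoped Pointwise in
/-- The translates of the tile by integer vectors cover the space: their union is closed and
invariant under `M⁻¹`, and it contains the integer vectors. -/
lemma iUnion_tile_add (hM : M.det ≠ 0) (hdil : IsDilation M) (hD : IsDigitSet M D) :
    ⋃ z : Fin d → ℤ, (· + realVec z) '' tile M D = Set.univ := by
  set T := ⋃ z : Fin d → ℤ, (· + realVec z) '' tile M D with hT
  have hclosed : IsClosed T := by
    have hrange : IsClosed (Set.range (realVec : (Fin d → ℤ) → Fin d → ℝ)) := by
      have : Set.range (realVec : (Fin d → ℤ) → Fin d → ℝ)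
          = Set.univ.pi fun _ => Set.range ((↑) : ℤ → ℝ) := by
        ext v
        simp only [Set.mem_range, Set.mem_univ_pi]
        refine ⟨?_, fun h => ?_⟩
        · rintro ⟨z, rfl⟩ i
          exact ⟨z i, rfl⟩
        · choose z hz using h
          exact ⟨z, funext hz⟩
      rw [this]
      exact isClosed_set_pi fun _ _ => Real.isClosed_range_intCast
    have : T = tile M D + Set.range (realVec : (Fin d → ℤ) → Fin d → ℝ) := by
      rw [← Set.iUnion_add_right_image, Set.biUnion_range]
    rw [this]
    exact hrange.vadd_left_of_isCompact (isCompact_tile hM hdil)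
  have hinv : ∀ x ∈ T, (realMat M ^ (-1 : ℤ)) *ᵥ x ∈ T := by
    intro x hx
    obtain ⟨z, u, ⟨a, ha, rfl, haz⟩, rfl⟩ := Set.mem_iUnion.1 hx
    obtain ⟨s, hs, w, rfl⟩ := exists_eq_digit_add hM hD z
    have h1 : repVal M a + realVec s ∈ cylSet M D (-1) 0 := by
      rw [cylSet_neg_one]
      refine Set.mem_biUnion hs ?_
      rw [cylSet_eq_image hM hdil hD.zero_mem 0 (isDigitSeq_single hD.zero_mem hs)]
      refine ⟨_, ⟨repVal M a, ⟨a, ha, rfl, haz⟩, rfl⟩, ?_⟩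
      have h2 : repVal M (headSeq 0 (Pi.single 0 s)) = realVec s := by
        rw [repVal, tsum_eq_single 0]
        · simp [headSeq]
        · intro j hj
          simp [headSeq, hj]
      simp [h2, add_comm]
    rw [cylSet_zero hM hdil hD.zero_mem] at h1
    obtain ⟨u, hu, hux⟩ := h1
    refine Set.mem_iUnion.2 ⟨w, u, hu, ?_⟩
    rw [Matrix.mulVecLin_apply, neg_neg] at hux
    simp only
    rw [realVec_add, ← add_assoc, Matrix.mulVec_add, ← hux, zpow_mulVec_cancel hM, realVec_mulVec]
    congr 1
    have := zpow_mulVec_cancel hM 1 (realVec w)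
    rw [zpow_one] at this
    exact this.symm
  have hpow : ∀ (n : ℕ) (z : Fin d → ℤ), (realMat M ^ (-(n : ℤ))) *ᵥ realVec z ∈ T := by
    intro n z
    induction n with
    | zero =>
      refine Set.mem_iUnion.2 ⟨z, 0, zero_mem_tile hD.zero_mem, ?_⟩
      simp
    | succ n ih =>
      have := hinv _ ih
      rw [mulVec_zpow_add hM] at this
      convert this using 3
      push_cast
      ring
  refine Set.eq_univ_of_forall fun x => ?_
  obtain ⟨b, hb, hb0, hle⟩ := exists_summable_bound hM hdil
  set y : ℕ → Fin d → ℝ := fun n => (realMat M ^ (n : ℤ)) *ᵥ x with hy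
  have hlim : Tendsto (fun n : ℕ => (realMat M ^ (-(n : ℤ))) *ᵥ realVec fun i => ⌊y n i⌋)
      atTop (𝓝 x) := by
    rw [tendsto_iff_norm_sub_tendsto_zero]
    refine squeeze_zero_norm (fun n => ?_) hb.tendsto_atTop_zero
    rw [norm_norm]
    have h1 : x = (realMat M ^ (-(n : ℤ))) *ᵥ y n := (zpow_mulVec_cancel hM n x).symm
    conv_lhs => rw [h1, ← Matrix.mulVec_sub]
    refine (hle n _).trans ?_
    have h2 : ‖(realVec fun i => ⌊y n i⌋) - y n‖ ≤ 1 := by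
      refine (pi_norm_le_iff_of_nonneg zero_le_one).2 fun i => ?_
      rw [Pi.sub_apply, realVec, Real.norm_eq_abs, abs_sub_comm, ← Int.fract, Int.abs_fract]
      exact (Int.fract_lt_one (y n i)).le
    exact mul_le_of_le_one_right (hb0 n) h2
  exact hclosed.mem_of_tendsto hlim (Eventually.of_forall fun n => hpow n _)

lemma volume_tile_pos (hM : M.det ≠ 0) (hdil : IsDilation M) (hD : IsDigitSet M D) :
    0 < volume (tile M D) := by
  rw [pos_iff_ne_zero]
  intro h
  have : volume (⋃ z : Fin d → ℤ, (· + realVec z) '' tile M D) = 0 := by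
    refine measure_iUnion_null fun z => ?_
    rw [Set.image_add_right, measure_preimage_add_right, h]
  rw [iUnion_tile_add hM hdil hD] at this
  exact (NeZero.ne (volume : Measure (Fin d → ℝ))) (Measure.measure_univ_eq_zero.1 this)

end Value

/-! ### The space of `M`-positive vectors as a digit space -/

section Digits

variable {d : ℕ} {M : Matrix (Fin d) (Fin d) ℤ} {D : Finset (Fin d → ℤ)}

lemma headSeq_congr {a b : ℤ → Fin d → ℤ} {k : ℤ} (h : ∀ j ≤ k, a j = b j) :
    headSeq k a = headSeq k b := by
  funext j
  simp only [headSeq]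
  split_ifs with hj
  exacts [h j hj, rfl]

lemma repVal_eq_head_add_tail (hM : M.det ≠ 0) (hdil : IsDilation M) (h0 : 0 ∈ D)
    {a : ℤ → Fin d → ℤ} (ha : IsDigitSeq D a) (k : ℤ) :
    repVal M a = repVal M (headSeq k a) + repVal M (tailSeq k a) := by
  rw [← repVal_head_add_tail hM hdil h0 ha ha]
  simp

/-- Two different representations of a vector differ first at some index; shifting this index
to `1` and removing the common leading digits gives a point of `Ũ`. -/
lemma eq_of_isRepr (hM : M.det ≠ 0) (hdil : IsDilation M) (h0 : 0 ∈ D) {x : Fin d → ℝ}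
    (hx : x ∉ XTilde M D) {a b : ℤ → Fin d → ℤ} (ha : IsRepr M D a x) (hb : IsRepr M D b x) :
    a = b := by
  rw [isRepr_iff hM hdil] at ha hb
  by_contra hne
  obtain ⟨i, hi⟩ := Function.ne_iff.1 hne
  obtain ⟨l, hl⟩ := ha.1.2
  obtain ⟨l', hl'⟩ := hb.1.2
  obtain ⟨j₀, hj₀, hmin⟩ := Int.exists_least_of_bdd (P := fun j => a j ≠ b j)
    ⟨-(l : ℤ) - l', fun z hz => by
      by_contra hlt
      exact hz (by rw [hl z (by omega), hl' z (by omega)])⟩ ⟨i, hi⟩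
  set n := j₀ - 1 with hn
  have ha' := ha.1.shift n
  have hb' := hb.1.shift n
  have hhead : headSeq 0 (fun j => a (j + n)) = headSeq 0 (fun j => b (j + n)) := by
    refine headSeq_congr fun j hj => ?_
    by_contra h
    have := hmin _ h
    omega
  have h1 := repVal_eq_head_add_tail hM hdil h0 ha' 0
  have h2 := repVal_eq_head_add_tail hM hdil h0 hb' 0
  rw [repVal_shift hM hdil ha.1, ha.2] at h1
  rw [repVal_shift hM hdil hb.1, hb.2, ← hhead, h1] at h2
  have h3 := add_left_cancel h2
  refine hx (Set.mem_iUnion₂.2 ⟨repVal M (headSeq 0 fun j => a (j + n)), ?_,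
    Set.mem_iUnion.2 ⟨-n, repVal M (tailSeq 0 fun j => a (j + n)), ?_, ?_⟩⟩)
  · refine ⟨_, (isRepr_iff hM hdil).2 ⟨ha'.head h0 0, rfl⟩, ?_⟩
    obtain ⟨l, hl⟩ := (ha'.head h0 0).2
    refine (Set.finite_Ioc (-(l : ℤ)) 0).subset fun j hj => ⟨?_, ?_⟩
    · by_contra h
      exact hj (hl j (by omega))
    · by_contra h
      exact hj (if_neg h)
  · refine ⟨tailSeq 0 fun j => a (j + n), tailSeq 0 fun j => b (j + n),
      (isRepr_iff hM hdil).2 ⟨ha'.tail h0 0, rfl⟩,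
      (isRepr_iff hM hdil).2 ⟨hb'.tail h0 0, h3.symm⟩, fun j hj => if_pos hj,
      fun j hj => if_pos hj, ?_⟩
    have : ¬ ((1 : ℤ) ≤ 0) := by norm_num
    simp only [tailSeq, if_neg this]
    rwa [show 1 + n = j₀ by omega]
  · simp only
    rw [add_comm, ← h1, zpow_mulVec_cancel hM]

lemma xZero_subset_xPlus : XZero M D ⊆ XPlus M D := fun _ ⟨a, ha, _⟩ => ⟨a, ha⟩

lemma x_subset_xPlus : X M D ⊆ XPlus M D :=
  Set.union_subset Set.sdiff_subset xZero_subset_xPlus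

lemma isRepr_digits {x : Fin d → ℝ} (hx : x ∈ XPlus M D) : IsRepr M D (digits M D x) x := by
  unfold digits
  split_ifs with h1 h2
  · exact h1.choose_spec.1
  · exact h2.choose_spec
  · exact absurd hx h2

lemma digits_mem (h0 : 0 ∈ D) (x : Fin d → ℝ) (j : ℤ) : digits M D x j ∈ D := by
  by_cases hx : x ∈ XPlus M D
  · exact (isRepr_digits hx).mem j
  · have h2 : ¬ ∃ a, IsRepr M D a x := hx
    have h1 : ¬ ∃ a, IsFiniteRepr M D a x := fun ⟨a, ha⟩ => h2 ⟨a, ha.1⟩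
    rw [digits, dif_neg h1, dif_neg h2]
    exact h0

lemma xPlus_eq_iUnion (hM : M.det ≠ 0) (hdil : IsDilation M) :
    XPlus M D = ⋃ l : ℕ, cylSet M D (-l) 0 := by
  ext x
  simp only [Set.mem_iUnion]
  constructor
  · rintro ⟨a, ha⟩
    obtain ⟨h1, h2⟩ := (isRepr_iff hM hdil).1 ha
    obtain ⟨l, hl⟩ := h1.2
    exact ⟨l, a, h1, h2, hl⟩
  · rintro ⟨l, a, h1, h2, -⟩
    exact ⟨a, (isRepr_iff hM hdil).2 ⟨h1, h2⟩⟩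

lemma cylSet_subset_xPlus (hM : M.det ≠ 0) (hdil : IsDilation M) (k : ℤ) (h : ℤ → Fin d → ℤ) :
    cylSet M D k h ⊆ XPlus M D := by
  rintro x ⟨a, h1, h2, -⟩
  exact ⟨a, (isRepr_iff hM hdil).2 ⟨h1, h2⟩⟩

lemma measurableSet_xPlus (hM : M.det ≠ 0) (hdil : IsDilation M) (h0 : 0 ∈ D) :
    MeasurableSet (XPlus M D) := by
  rw [xPlus_eq_iUnion hM hdil]
  exact MeasurableSet.iUnion fun l =>
    (isCompact_cylSet hM hdil h0 _ (isDigitSeq_zero h0)).measurableSet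

/-- A measurable null set outside of which vectors have at most one representation, which is not
finite. -/
def badSet (M : Matrix (Fin d) (Fin d) ℤ) (D : Finset (Fin d → ℤ)) : Set (Fin d → ℝ) :=
  toMeasurable volume (XTilde M D ∪ XZero M D)

/-- A measurable subset of full measure of `X`, consisting of vectors with exactly one
representation. -/
def goodSet (M : Matrix (Fin d) (Fin d) ℤ) (D : Finset (Fin d → ℤ)) : Set (Fin d → ℝ) :=
  XPlus M D \ badSet M D

lemma volume_badSet [NeZero d] (hM : M.det ≠ 0) (hdil : IsDilation M) (hD : IsDigitSet M D) :
    volume (badSet M D) = 0 := by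
  rw [badSet, measure_toMeasurable]
  exact measure_union_null (volume_xTilde hM hdil hD) ((countable_xZero M D).measure_zero _)

lemma measurableSet_goodSet (hM : M.det ≠ 0) (hdil : IsDilation M) (h0 : 0 ∈ D) :
    MeasurableSet (goodSet M D) :=
  (measurableSet_xPlus hM hdil h0).diff (measurableSet_toMeasurable _ _)

lemma notMem_xTilde_of_mem_goodSet {x : Fin d → ℝ} (hx : x ∈ goodSet M D) : x ∉ XTilde M D :=
  fun h => hx.2 (subset_toMeasurable _ _ (Or.inl h))

lemma goodSet_subset_x : goodSet M D ⊆ X M D :=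
  fun _ hx => Or.inl ⟨hx.1, notMem_xTilde_of_mem_goodSet hx⟩

lemma mem_cylSet_iff (hM : M.det ≠ 0) (hdil : IsDilation M) (h0 : 0 ∈ D) {x : Fin d → ℝ}
    (hx : x ∈ goodSet M D) {k : ℤ} {h : ℤ → Fin d → ℤ} :
    x ∈ cylSet M D k h ↔ ∀ j ≤ k, digits M D x j = h j := by
  have hr := isRepr_digits hx.1
  constructor
  · rintro ⟨a, h1, h2, h3⟩
    rwa [eq_of_isRepr hM hdil h0 (notMem_xTilde_of_mem_goodSet hx) hr
      ((isRepr_iff hM hdil).2 ⟨h1, h2⟩)]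
  · intro h3
    obtain ⟨h1, h2⟩ := (isRepr_iff hM hdil).1 hr
    exact ⟨_, h1, h2, h3⟩

lemma muX_eq (hM : M.det ≠ 0) (hdil : IsDilation M) (hD : IsDigitSet M D) :
    muX M D = volume.restrict (XPlus M D) := by
  refine Measure.restrict_congr_set (ae_eq_set.2 ⟨?_, ?_⟩)
  · rw [Set.sdiff_eq_empty.2 x_subset_xPlus, measure_empty]
  · refine measure_mono_null (fun x hx => ?_) (volume_xTilde hM hdil hD)
    by_contra h
    exact hx.2 (Or.inl ⟨hx.1, h⟩)

lemma ae_mem_goodSet [NeZero d] (hM : M.det ≠ 0) (hdil : IsDilation M) (hD : IsDigitSet M D) :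
    ∀ᵐ x ∂muX M D, x ∈ goodSet M D := by
  rw [muX_eq hM hdil hD, ae_restrict_iff' (measurableSet_xPlus hM hdil hD.zero_mem)]
  filter_upwards [measure_eq_zero_iff_ae_notMem.1 (volume_badSet hM hdil hD)] with x hx hx'
  exact ⟨hx', hx⟩

/-- The digit `0` as an element of the digit set. -/
instance digitZero [h : Fact ((0 : Fin d → ℤ) ∈ D)] : Zero D := ⟨⟨0, h.out⟩⟩

lemma coe_digit_zero [Fact ((0 : Fin d → ℤ) ∈ D)] : ((0 : D) : Fin d → ℤ) = 0 := rfl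

lemma coe_digit_eq_zero [Fact ((0 : Fin d → ℤ) ∈ D)] {s : D} : (s : Fin d → ℤ) = 0 ↔ s = 0 :=
  ⟨fun h => Subtype.ext h, fun h => by rw [h, coe_digit_zero]⟩

open Classical in
/-- The digits of the vectors of `goodSet M D`, as elements of `D`. They are set to `0` elsewhere,
which makes them measurable. -/
noncomputable def goodDigits (M : Matrix (Fin d) (Fin d) ℤ) (D : Finset (Fin d → ℤ))
    [h : Fact ((0 : Fin d → ℤ) ∈ D)] (x : Fin d → ℝ) (j : ℤ) : D :=
  if x ∈ goodSet M D then ⟨digits M D x j, digits_mem h.out x j⟩ else 0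

variable [hfact : Fact ((0 : Fin d → ℤ) ∈ D)]

lemma coe_goodDigits {x : Fin d → ℝ} (hx : x ∈ goodSet M D) (j : ℤ) :
    (goodDigits M D x j : Fin d → ℤ) = digits M D x j := by
  rw [goodDigits, if_pos hx]

lemma leftFinite_goodDigits (x : Fin d → ℝ) : LeftFinite (goodDigits M D x) := by
  by_cases hx : x ∈ goodSet M D
  · obtain ⟨l, hl⟩ := finite_neg_iff_leftFinite.1 (isRepr_digits hx.1).finite_neg
    exact ⟨l, fun j hj => coe_digit_eq_zero.1 (by rw [coe_goodDigits hx, hl j hj])⟩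
  · exact ⟨0, fun j _ => by rw [goodDigits, if_neg hx]⟩

lemma isDigitSeq_coe {h : ℤ → D} (hh : LeftFinite h) :
    IsDigitSeq D fun j => (h j : Fin d → ℤ) := by
  obtain ⟨l, hl⟩ := hh
  exact ⟨fun j => (h j).2, l, fun j hj => congrArg Subtype.val (hl j hj)⟩

lemma mem_cyl_goodDigits (hM : M.det ≠ 0) (hdil : IsDilation M) {x : Fin d → ℝ}
    (hx : x ∈ goodSet M D) {k : ℤ} {h : ℤ → D} :
    x ∈ cyl (goodDigits M D) k h ↔ x ∈ cylSet M D k fun j => (h j : Fin d → ℤ) := by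
  rw [mem_cylSet_iff hM hdil hfact.out hx]
  refine forall₂_congr fun j _ => ?_
  rw [← coe_goodDigits hx, Subtype.ext_iff]

lemma measurableSet_cyl_goodDigits (hM : M.det ≠ 0) (hdil : IsDilation M) (k : ℤ) {h : ℤ → D}
    (hh : LeftFinite h) : MeasurableSet (cyl (goodDigits M D) k h) := by
  have hG := measurableSet_goodSet hM hdil hfact.out
  have h1 : cyl (goodDigits M D) k h ∩ goodSet M D
      = cylSet M D k (fun j => (h j : Fin d → ℤ)) ∩ goodSet M D := by
    ext x
    exact and_congr_left fun hx => mem_cyl_goodDigits hM hdil hx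
  have h2 : cyl (goodDigits M D) k h \ goodSet M D
      = (goodSet M D)ᶜ ∩ {_x | ∀ j ≤ k, 0 = h j} := by
    ext x
    rw [Set.mem_sdiff, and_comm]
    refine and_congr_right fun hx => forall₂_congr fun j _ => ?_
    rw [goodDigits, if_neg hx]
  rw [← Set.inter_union_sdiff (cyl (goodDigits M D) k h) (goodSet M D), h1, h2]
  exact ((isCompact_cylSet hM hdil hfact.out k (isDigitSeq_coe hh)).measurableSet.inter hG).union
    (hG.compl.inter (MeasurableSet.const _))

lemma cyl_goodDigits_ae_eq [NeZero d] (hM : M.det ≠ 0) (hdil : IsDilation M) (hD : IsDigitSet M D)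
    (k : ℤ) (h : ℤ → D) :
    cyl (goodDigits M D) k h =ᵐ[muX M D] cylSet M D k fun j => (h j : Fin d → ℤ) := by
  filter_upwards [ae_mem_goodSet hM hdil hD] with x hx
  exact propext (mem_cyl_goodDigits hM hdil hx)

lemma restrict_cyl_goodDigits [NeZero d] (hM : M.det ≠ 0) (hdil : IsDilation M)
    (hD : IsDigitSet M D) (k : ℤ) {h : ℤ → D} (hh : LeftFinite h) :
    (muX M D).restrict (cyl (goodDigits M D) k h)
      = volume.restrict (cylSet M D k fun j => (h j : Fin d → ℤ)) := by
  rw [Measure.restrict_congr_set (cyl_goodDigits_ae_eq hM hdil hD k h), muX_eq hM hdil hD,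
    Measure.restrict_restrict
      (isCompact_cylSet hM hdil hD.zero_mem k (isDigitSeq_coe hh)).measurableSet,
    Set.inter_eq_self_of_subset_left (cylSet_subset_xPlus hM hdil k _)]

/-- A vector is the limit of its truncated expansions. -/
lemma tendsto_sum_goodDigits {x : Fin d → ℝ} (hx : x ∈ goodSet M D) :
    Tendsto (fun n : ℕ => ∑ j ∈ Finset.Ioc (-(n : ℤ)) n,
      (realMat M ^ (-j)) *ᵥ realVec (goodDigits M D x j : Fin d → ℤ)) atTop (𝓝 x) := by
  simp_rw [coe_goodDigits hx]
  exact (isRepr_digits hx.1).hasSum.comp Finset.tendsto_Ioc_neg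

/-- A function whose integrals over all cylinders vanish is orthogonal to the test functions, as
these are limits of functions that are constant on cylinders. -/
lemma ae_eq_zero_of_forall_cyl [NeZero d] (hM : M.det ≠ 0) (hdil : IsDilation M)
    (hD : IsDigitSet M D) {f : (Fin d → ℝ) → ℂ} (l : ℕ)
    (hf : IntegrableOn f (cyl (goodDigits M D) (-l) 0) (muX M D))
    (h : ∀ (k : ℕ) h, LeftFinite h → ∫ x in cyl (goodDigits M D) k h, f x ∂muX M D = 0) :
    ∀ᵐ x ∂(muX M D).restrict (cyl (goodDigits M D) (-l) 0), f x = 0 := by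
  refine ae_eq_zero_of_integral_contDiff_smul_eq_zero hf.locallyIntegrable fun g hg hgc => ?_
  set v : ℕ → (ℤ → D) → Fin d → ℝ := fun n a =>
    ∑ j ∈ Finset.Ioc (-(n : ℤ)) n, (realMat M ^ (-j)) *ᵥ realVec (a j : Fin d → ℤ) with hv
  obtain ⟨B, hB⟩ := hg.continuous.bounded_above_of_compact_support hgc
  have hmeas : ∀ (n : ℕ) (t : Finset.Ioc (-(l : ℤ)) n → D),
      MeasurableSet (cyl (goodDigits M D) n (extendZero t)) := fun n t =>
    measurableSet_cyl_goodDigits hM hdil _ (leftFinite_extendZero t)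
  have hconst : ∀ (n : ℕ) (t : Finset.Ioc (-(l : ℤ)) n → D),
      ∀ x ∈ cyl (goodDigits M D) n (extendZero t),
        g (v n (goodDigits M D x)) • f x = g (v n (extendZero t)) • f x := by
    intro n t x hx
    congr 2
    refine Finset.sum_congr rfl fun j hj => ?_
    rw [hx j (Finset.mem_Ioc.1 hj).2]
  have hint : ∀ (n : ℕ) (t : Finset.Ioc (-(l : ℤ)) n → D),
      IntegrableOn (fun x => g (v n (goodDigits M D x)) • f x)
        (cyl (goodDigits M D) n (extendZero t)) (muX M D) := fun n t =>
    IntegrableOn.congr_fun ((hf.mono_set (cyl_extendZero_subset t)).smul (g (v n (extendZero t))))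
      (fun x hx => (hconst n t x hx).symm) (hmeas n t)
  have hzero : ∀ n : ℕ, ∫ x in cyl (goodDigits M D) (-l) 0,
      g (v n (goodDigits M D x)) • f x ∂muX M D = 0 := by
    intro n
    rw [← iUnion_cyl_extendZero l n, integral_iUnion_fintype (hmeas n)
      (pairwise_disjoint_cyl_extendZero l n) (hint n)]
    refine Finset.sum_eq_zero fun t _ => ?_
    rw [setIntegral_congr_fun (hmeas n t) (hconst n t), integral_smul,
      h n _ (leftFinite_extendZero t), smul_zero]
  have hlim := tendsto_integral_of_dominated_convergence
    (μ := (muX M D).restrict (cyl (goodDigits M D) (-l) 0))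
    (F := fun (n : ℕ) x => g (v n (goodDigits M D x)) • f x) (f := fun x => g x • f x)
    (fun x => B * ‖f x‖) (fun n => ?_) (hf.norm.const_mul B) (fun n => ?_) ?_
  · simp_rw [hzero] at hlim
    exact (tendsto_nhds_unique hlim tendsto_const_nhds)
  · rw [← iUnion_cyl_extendZero l n]
    exact (integrableOn_finite_iUnion.2 (hint n)).1
  · refine Eventually.of_forall fun x => ?_
    rw [norm_smul]
    exact mul_le_mul_of_nonneg_right (hB _) (norm_nonneg _)
  · filter_upwards [ae_restrict_of_ae (ae_mem_goodSet hM hdil hD)] with x hx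
    exact ((hg.continuous.tendsto x).comp (tendsto_sum_goodDigits hx)).smul_const _

/-- The `M`-positive vectors form a digit space. -/
theorem isDigitSpace_muX [NeZero d] (hM : M.det ≠ 0) (hdil : IsDilation M)
    (hD : IsDigitSet M D) :
    IsDigitSpace (muX M D) (goodDigits M D) (volume (tile M D)).toReal := by
  have hmeas : ∀ (k : ℤ) (h : ℤ → D), LeftFinite h → muX M D (cyl (goodDigits M D) k h)
      = ENNReal.ofReal ((volume (tile M D)).toReal * (Fintype.card D : ℝ) ^ (-k)) := by
    intro k h hh
    rw [← Measure.restrict_apply_univ, restrict_cyl_goodDigits hM hdil hD k hh,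
      Measure.restrict_apply_univ, volume_cylSet hM hdil hD.zero_mem k (isDigitSeq_coe hh),
      mul_comm, ENNReal.ofReal_mul ENNReal.toReal_nonneg,
      ENNReal.ofReal_toReal (volume_tile_lt_top hM hdil).ne, Fintype.card_coe, hD.card_eq]
  refine ⟨ENNReal.toReal_pos (volume_tile_pos hM hdil hD).ne' (volume_tile_lt_top hM hdil).ne,
    leftFinite_goodDigits, fun k h => measurableSet_cyl_goodDigits hM hdil k, hmeas,
    fun f hf => ?_⟩
  have h1 : ∀ l : ℕ,
      ∀ᵐ x ∂(muX M D).restrict (cyl (goodDigits M D) (-l) 0), f x = 0 := by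
    intro l
    refine ae_eq_zero_of_forall_cyl hM hdil hD l ?_ hf
    have : IsFiniteMeasure ((muX M D).restrict (cyl (goodDigits M D) (-l) 0)) :=
      ⟨by rw [Measure.restrict_apply_univ, hmeas _ _ leftFinite_zero]; exact ENNReal.ofReal_lt_top⟩
    exact ((Lp.memLp f).restrict _).integrable one_le_two
  rw [← ae_restrict_iUnion_iff, iUnion_cyl_zero leftFinite_goodDigits,
    Measure.restrict_univ] at h1
  refine Lp.ext ?_
  filter_upwards [h1, Lp.coeFn_zero ℂ 2 (muX M D)] with x hx hx'
  rw [hx, hx', Pi.zero_apply]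

end Digits

/-! ### The set `U` and the tile -/

section UnitSet

variable {d : ℕ} {M : Matrix (Fin d) (Fin d) ℤ} {D : Finset (Fin d → ℤ)}

lemma u_subset_tile (hM : M.det ≠ 0) (hdil : IsDilation M) : U M D ⊆ tile M D := by
  rintro x ⟨hx, hz⟩
  obtain ⟨h1, h2⟩ := (isRepr_iff hM hdil).1 (isRepr_digits (x_subset_xPlus hx))
  exact ⟨_, h1, h2, hz⟩

lemma volume_tile_sdiff_u [NeZero d] (hM : M.det ≠ 0) (hdil : IsDilation M)
    (hD : IsDigitSet M D) : volume (tile M D \ U M D) = 0 := by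
  refine measure_mono_null (fun x hx => ?_) (volume_badSet hM hdil hD)
  by_contra h
  have hG : x ∈ goodSet M D := ⟨cylSet_subset_xPlus hM hdil _ _ hx.1, h⟩
  exact hx.2 ⟨goodSet_subset_x hG, (mem_cylSet_iff hM hdil hD.zero_mem hG).1 hx.1⟩

lemma volume_u [NeZero d] (hM : M.det ≠ 0) (hdil : IsDilation M) (hD : IsDigitSet M D) :
    volume (U M D) = volume (tile M D) :=
  measure_congr (ae_eq_set.2 ⟨by rw [Set.sdiff_eq_empty.2 (u_subset_tile hM hdil), measure_empty],
    volume_tile_sdiff_u hM hdil hD⟩)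

lemma image_u_ae_eq [NeZero d] (hM : M.det ≠ 0) (hdil : IsDilation M) (hD : IsDigitSet M D)
    (l : ℕ) : (fun u : Fin d → ℝ => (realMat M ^ l) *ᵥ u) '' U M D
      =ᵐ[volume] cylSet M D (-l) 0 := by
  have h1 : (fun u : Fin d → ℝ => (realMat M ^ l) *ᵥ u) = (realMat M ^ (l : ℤ)).mulVecLin := by
    rw [zpow_natCast]; rfl
  rw [cylSet_zero hM hdil hD.zero_mem, neg_neg, h1]
  refine ae_eq_set.2 ⟨?_, measure_mono_null (t := (realMat M ^ (l : ℤ)).mulVecLin ''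
    (tile M D \ U M D)) ?_ ?_⟩
  · rw [Set.sdiff_eq_empty.2 (Set.image_mono (u_subset_tile hM hdil)), measure_empty]
  · rintro _ ⟨⟨u, hu, rfl⟩, hu'⟩
    exact ⟨u, ⟨hu, fun h => hu' ⟨u, h, rfl⟩⟩, rfl⟩
  · rw [volume_image_zpow, volume_tile_sdiff_u hM hdil hD, mul_zero]

end UnitSet

/-! ### The kernel and the truncated transforms on `M`-positive vectors -/

section Kernel

variable {d : ℕ} {M : Matrix (Fin d) (Fin d) ℤ} {D D' : Finset (Fin d → ℤ)}
  [hfact : Fact ((0 : Fin d → ℤ) ∈ D)] [hfact' : Fact ((0 : Fin d → ℤ) ∈ D')]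

/-- The kernel `χ`, computed with the measurable digits. -/
noncomputable def goodChi (M : Matrix (Fin d) (Fin d) ℤ) (D D' : Finset (Fin d → ℤ))
    [Fact ((0 : Fin d → ℤ) ∈ D)] [Fact ((0 : Fin d → ℤ) ∈ D')] (x ω : Fin d → ℝ) : ℂ :=
  Complex.exp (2 * (Real.pi : ℂ) * Complex.I *
    ((∑ᶠ j : ℤ, pairing M (goodDigits M D x j) (goodDigits Mᵀ D' ω (1 - j)) : ℝ) : ℂ))

lemma goodChi_eq_chi {x ω : Fin d → ℝ} (hx : x ∈ goodSet M D) (hω : ω ∈ goodSet Mᵀ D') :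
    goodChi M D D' x ω = chi M D D' x ω := by
  simp only [goodChi, chi, coe_goodDigits hx, coe_goodDigits hω, pairing]

lemma goodChi_eq_prod (l k : ℕ) {x ω : Fin d → ℝ} (hx : x ∈ cyl (goodDigits M D) (-l) 0)
    (hω : ω ∈ cyl (goodDigits Mᵀ D') (-k) 0) :
    goodChi M D D' x ω = ∏ j ∈ Finset.Ioc (-(l : ℤ)) k,
      expPairing M (goodDigits M D x j) (goodDigits Mᵀ D' ω (1 - j)) := by
  have hsupp : (Function.support fun j : ℤ =>
      pairing M (goodDigits M D x j) (goodDigits Mᵀ D' ω (1 - j)))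
        ⊆ (Finset.Ioc (-(l : ℤ)) k : Finset ℤ) := by
    intro j hj
    rw [Finset.mem_coe, Finset.mem_Ioc]
    by_contra h
    refine hj ?_
    by_cases hj1 : j ≤ -(l : ℤ)
    · simp [pairing, hx j hj1, coe_digit_zero]
    · simp [pairing, hω (1 - j) (by omega), coe_digit_zero]
  rw [goodChi, finsum_eq_sum_of_support_subset _ hsupp, Complex.ofReal_sum, Finset.mul_sum,
    Complex.exp_sum]
  rfl

lemma isDigitKernel_goodChi (hM : M.det ≠ 0) (hD : IsDigitSet M D) (hD' : IsDigitSet Mᵀ D') :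
    IsDigitKernel (goodDigits M D) (goodDigits Mᵀ D')
      (fun (s : D) (t : D') => expPairing M s t) (goodChi M D D') where
  card_eq := by
    rw [Fintype.card_coe, Fintype.card_coe, hD.card_eq, hD'.card_eq, Matrix.det_transpose]
  norm_eq s t := norm_expPairing _ _
  orthogonal s s' hne :=
    sum_expPairing_mul_conj hM hD hD' s.2 s'.2 fun h => hne (Subtype.ext h)
  orthogonal' t t' hne := by
    have hD'' : IsDigitSet Mᵀᵀ D := by rwa [Matrix.transpose_transpose]
    simp_rw [← expPairing_transpose (M := M)]
    exact sum_expPairing_mul_conj (by rwa [Matrix.det_transpose]) hD' hD'' t.2 t'.2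
      fun h => hne (Subtype.ext h)
  eq_prod l k _ _ hx hω := goodChi_eq_prod l k hx hω

lemma j_eq_truncTransform [NeZero d] (hM : M.det ≠ 0) (hdil : IsDilation M) (hD : IsDigitSet M D)
    (l : ℕ) (f : (Fin d → ℝ) → ℂ) {ω : Fin d → ℝ} (hω : ω ∈ goodSet Mᵀ D') :
    J M D D' l f ω = truncTransform (muX M D) (goodDigits M D) (goodChi M D D')
      (volume (tile M D)).toReal l f ω := by
  have h1 : ∫ x in cyl (goodDigits M D) (-l) 0, f x * (starRingEnd ℂ) (chi M D D' x ω) ∂muX M D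
      = ∫ x in cyl (goodDigits M D) (-l) 0,
        f x * (starRingEnd ℂ) (goodChi M D D' x ω) ∂muX M D := by
    refine integral_congr_ae ?_
    filter_upwards [ae_restrict_of_ae (ae_mem_goodSet hM hdil hD)] with x hx
    rw [goodChi_eq_chi hx hω]
  have h2 : (fun j => ((0 : ℤ → D) j : Fin d → ℤ)) = 0 := rfl
  rw [J, truncTransform, volume_u hM hdil hD, ← h1,
    restrict_cyl_goodDigits hM hdil hD _ leftFinite_zero, h2,
    setIntegral_congr_set (image_u_ae_eq hM hdil hD l)]

variable [NeZero d] (hM : M.det ≠ 0) (hdil : IsDilation M) (hD : IsDigitSet M D)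
  (hD' : IsDigitSet Mᵀ D')

/-- The truncated Fourier transform `J_l` as an operator. -/
noncomputable def opJ (l : ℕ) : Lp ℂ 2 (muX M D) →L[ℂ] Lp ℂ 2 (muX Mᵀ D') :=
  truncOp (isDigitSpace_muX hM hdil hD)
    (isDigitSpace_muX (by rwa [Matrix.det_transpose]) hdil.transpose hD')
    (isDigitKernel_goodChi hM hD hD') l

lemma coeFn_opJ (l : ℕ) (f : Lp ℂ 2 (muX M D)) :
    opJ hM hdil hD hD' l f =ᵐ[muX Mᵀ D'] J M D D' l f := by
  have hM' : Mᵀ.det ≠ 0 := by rwa [Matrix.det_transpose]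
  filter_upwards [coeFn_truncOp (isDigitSpace_muX hM hdil hD)
    (isDigitSpace_muX hM' hdil.transpose hD') (isDigitKernel_goodChi hM hD hD') l f,
    ae_mem_goodSet hM' hdil.transpose hD'] with ω h1 h2
  rw [j_eq_truncTransform hM hdil hD l f h2]
  exact h1

lemma isFourierTransform_iff (f : Lp ℂ 2 (muX M D)) (F : Lp ℂ 2 (muX Mᵀ D')) :
    IsFourierTransform M D D' f F
      ↔ Tendsto (fun l => opJ hM hdil hD hD' l f) atTop (𝓝 F) := by
  rw [Lp.tendsto_Lp_iff_tendsto_eLpNorm']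
  have h1 : ∀ l, eLpNorm (J M D D' l f - (F : (Fin d → ℝ) → ℂ)) 2 (muX Mᵀ D')
      = eLpNorm (⇑(opJ hM hdil hD hD' l f) - ⇑F) 2 (muX Mᵀ D') := fun l =>
    eLpNorm_congr_ae ((coeFn_opJ hM hdil hD hD' l f).symm.sub (ae_eq_refl _))
  simp only [IsFourierTransform, h1]
  exact and_iff_right fun l => (memLp_congr_ae (coeFn_opJ hM hdil hD hD' l f)).1 (Lp.memLp _)

end Kernel

end MPositive

theorem mainTheorem7 (d : ℕ) (M : Matrix (Fin d) (Fin d) ℤ) (D D' : Finset (Fin d → ℤ))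
    (hdet : 2 ≤ M.det.natAbs) (hM : MPositive.IsDilation M)
    (hD : MPositive.IsDigitSet M D) (hD' : MPositive.IsDigitSet M.transpose D') :
    (∀ f : MeasureTheory.Lp ℂ 2 (MPositive.muX M D),
      ∃! F : MeasureTheory.Lp ℂ 2 (MPositive.muX M.transpose D'),
        MPositive.IsFourierTransform M D D' f F) ∧
    (∀ g : MeasureTheory.Lp ℂ 2 (MPositive.muX M.transpose D'),
      ∃ f : MeasureTheory.Lp ℂ 2 (MPositive.muX M D),
        MPositive.IsFourierTransform M D D' f g) := by
  have hdet0 : M.det ≠ 0 := by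
    intro h
    simp [h] at hdet
  -- In dimension zero the determinant is `1`.
  have : NeZero d := ⟨by
    rintro rfl
    simp at hdet⟩
  have : Fact (0 ∈ D) := ⟨hD.zero_mem⟩
  have : Fact (0 ∈ D') := ⟨hD'.zero_mem⟩
  obtain ⟨T, hT, hlim⟩ := MPositive.exists_surjective_transform
    (MPositive.isDigitSpace_muX hdet0 hM hD)
    (MPositive.isDigitSpace_muX (by rwa [Matrix.det_transpose]) hM.transpose hD')
    (MPositive.isDigitKernel_goodChi hdet0 hD hD')
  simp only [MPositive.isFourierTransform_iff hdet0 hM hD hD']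
  refine ⟨fun f => ⟨T f, hlim f, fun F hF => tendsto_nhds_unique hF (hlim f)⟩, fun g => ?_⟩
  obtain ⟨f, rfl⟩ := hT g
  exact ⟨f, hlim f⟩
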